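/- Let $n\ge 3$ and let $(M,g)$ be a generalized Robertson–Walker (GRW) space-time of dimension $n$ with Chen vector $X$, i.e. $(M,g)$ is a smooth $n$-dimensional Lorentzian manifold (signature $(-,+,\dots,+)$, Levi-Civita connection $\nabla$) and $X$ is a smooth vector field on $M$ such that $X^2:=X^jX_j<0$ everywhere and $$\nabla_jX_k=\rho\, g_{jk}$$ for some smooth scalar field $\rho$. Let $R_{jklm}$ be the Riemann tensor, with $(\nabla_i\nabla_j-\nabla_j\nabla_i)X_k=R_{ijk}{}^mX_m$, let $R_{jl}=g^{km}R_{jklm}$ be the Ricci tensor, $R=g^{jl}R_{jl}$ the curvature scalar, and let $$C_{jklm}=R_{jklm}+\frac{g_{jm}R_{kl}-g_{km}R_{jl}+R_{jm}g_{kl}-R_{km}g_{jl}}{n-2}-R\,\frac{g_{jm}g_{kl}-g_{jl}g_{km}}{(n-1)(n-2)}$$ be the Weyl tensor. Then $C_{jklm}X^m=0$ on $M$ if and only if there are smooth scalar fields $\alpha,\beta$ on $M$ such that $$R_{jk}=\alpha\, g_{jk}+\beta\,\frac{X_jX_k}{X^2}\quad\text{on } M.$$ -/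

import Mathlib

open scoped Manifold ContDiff
open Bundle

namespace GRW

noncomputable section

/-- A smooth Lorentzian metric on an `n`-dimensional smooth manifold `M`: a smooth section of
symmetric bilinear forms on the tangent spaces, with signature `(1, n - 1)`: each tangent space has
a vector `v` with `g v v < 0` on whose orthogonal complement `g` is positive definite. -/
structure LorentzMetric (n : ℕ) (M : Type*) [TopologicalSpace M]
    [ChartedSpace (EuclideanSpace ℝ (Fin n)) M] [IsManifold (𝓡 n) ∞ M] where
  /-- The bilinear form on each tangent space. -/
  val : ∀ p : M, TangentSpace (𝓡 n) p →L[ℝ] TangentSpace (𝓡 n) p →L[ℝ] ℝ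
  symm : ∀ (p : M) (v w : TangentSpace (𝓡 n) p), val p v w = val p w v
  signature : ∀ p : M, ∃ v : TangentSpace (𝓡 n) p, val p v v < 0 ∧
    ∀ w : TangentSpace (𝓡 n) p, val p v w = 0 → w ≠ 0 → 0 < val p w w
  contMDiff : ContMDiff (𝓡 n)
    ((𝓡 n).prod 𝓘(ℝ, EuclideanSpace ℝ (Fin n) →L[ℝ] EuclideanSpace ℝ (Fin n) →L[ℝ] ℝ)) ∞
    (fun p ↦ TotalSpace.mk'
      (EuclideanSpace ℝ (Fin n) →L[ℝ] EuclideanSpace ℝ (Fin n) →L[ℝ] ℝ) p (val p))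

/-- The partial derivative `∂_i f` of a function of the coordinates. -/
def pd {n : ℕ} (i : Fin n) (f : EuclideanSpace ℝ (Fin n) → ℝ) (x : EuclideanSpace ℝ (Fin n)) : ℝ :=
  fderiv ℝ f x (EuclideanSpace.single i 1)

section Coordinates

variable {n : ℕ} {M : Type*} [TopologicalSpace M] [ChartedSpace (EuclideanSpace ℝ (Fin n)) M]
  [IsManifold (𝓡 n) ∞ M]

/-- The coordinate vector `∂_i` of the chart `e`, at the point of `M` with coordinates `x`. -/
def frame (e : OpenPartialHomeomorph M (EuclideanSpace ℝ (Fin n))) (x : EuclideanSpace ℝ (Fin n))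
    (i : Fin n) : TangentSpace (𝓡 n) (e.symm x) :=
  mfderiv (𝓡 n) (𝓡 n) e.symm x (EuclideanSpace.single i (1 : ℝ) : EuclideanSpace ℝ (Fin n))

/-- The contravariant components `X^i` of a vector field in the chart `e`. -/
def upper (X : ∀ p : M, TangentSpace (𝓡 n) p)
    (e : OpenPartialHomeomorph M (EuclideanSpace ℝ (Fin n))) (i : Fin n)
    (x : EuclideanSpace ℝ (Fin n)) : ℝ :=
  let v : EuclideanSpace ℝ (Fin n) := mfderiv (𝓡 n) (𝓡 n) e (e.symm x) (X (e.symm x))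
  v i

variable (g : LorentzMetric n M)

/-- The components `g_ij` of the metric in the chart `e`. -/
def metric (e : OpenPartialHomeomorph M (EuclideanSpace ℝ (Fin n))) (i j : Fin n)
    (x : EuclideanSpace ℝ (Fin n)) : ℝ :=
  g.val (e.symm x) (frame e x i) (frame e x j)

/-- The components `g^ij` of the inverse metric. -/
def invMetric (e : OpenPartialHomeomorph M (EuclideanSpace ℝ (Fin n))) (i j : Fin n)
    (x : EuclideanSpace ℝ (Fin n)) : ℝ :=
  (Matrix.of fun a b ↦ metric g e a b x)⁻¹ i j

/-- The Christoffel symbols `Γ^k_ij` of the Levi-Civita connection. -/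
def christoffel (e : OpenPartialHomeomorph M (EuclideanSpace ℝ (Fin n))) (k i j : Fin n)
    (x : EuclideanSpace ℝ (Fin n)) : ℝ :=
  (1 / 2 : ℝ) * ∑ l, invMetric g e k l x *
    (pd i (metric g e j l) x + pd j (metric g e i l) x - pd l (metric g e i j) x)

/-- The covariant components `X_k = g_kl X^l` of a vector field. -/
def lower (X : ∀ p : M, TangentSpace (𝓡 n) p)
    (e : OpenPartialHomeomorph M (EuclideanSpace ℝ (Fin n))) (k : Fin n)
    (x : EuclideanSpace ℝ (Fin n)) : ℝ :=
  ∑ l, metric g e k l x * upper X e l x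

/-- The components `∇_j X_k = ∂_j X_k - Γ^l_jk X_l` of the covariant derivative. -/
def covDeriv (X : ∀ p : M, TangentSpace (𝓡 n) p)
    (e : OpenPartialHomeomorph M (EuclideanSpace ℝ (Fin n))) (j k : Fin n)
    (x : EuclideanSpace ℝ (Fin n)) : ℝ :=
  pd j (lower g X e k) x - ∑ l, christoffel g e l j k x * lower g X e l x

/-- The components `R_ijk^m` of the Riemann tensor, with the sign convention
`(∇_i ∇_j - ∇_j ∇_i) X_k = R_ijk^m X_m`. -/
def riemannUp (e : OpenPartialHomeomorph M (EuclideanSpace ℝ (Fin n))) (i j k m : Fin n)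
    (x : EuclideanSpace ℝ (Fin n)) : ℝ :=
  pd j (christoffel g e m i k) x - pd i (christoffel g e m j k) x
    + ∑ l, (christoffel g e m j l x * christoffel g e l i k x
      - christoffel g e m i l x * christoffel g e l j k x)

/-- The components `R_ijkm` of the Riemann tensor. -/
def riemann (e : OpenPartialHomeomorph M (EuclideanSpace ℝ (Fin n))) (i j k m : Fin n)
    (x : EuclideanSpace ℝ (Fin n)) : ℝ :=
  ∑ l, riemannUp g e i j k l x * metric g e l m x

/-- The Ricci tensor `R_jl = g^km R_jklm`. -/
def ricci (e : OpenPartialHomeomorph M (EuclideanSpace ℝ (Fin n))) (j l : Fin n)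
    (x : EuclideanSpace ℝ (Fin n)) : ℝ :=
  ∑ k, ∑ m, invMetric g e k m x * riemann g e j k l m x

/-- The curvature scalar `R = g^jl R_jl`. -/
def scalarCurv (e : OpenPartialHomeomorph M (EuclideanSpace ℝ (Fin n)))
    (x : EuclideanSpace ℝ (Fin n)) : ℝ :=
  ∑ j, ∑ l, invMetric g e j l x * ricci g e j l x

/-- The Weyl tensor `C_jklm` (for `n ≥ 3`). -/
def weyl (e : OpenPartialHomeomorph M (EuclideanSpace ℝ (Fin n))) (j k l m : Fin n)
    (x : EuclideanSpace ℝ (Fin n)) : ℝ :=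
  riemann g e j k l m x
    + 1 / ((n : ℝ) - 2) *
      (metric g e j m x * ricci g e k l x - metric g e k m x * ricci g e j l x
        + ricci g e j m x * metric g e k l x - ricci g e k m x * metric g e j l x)
    - scalarCurv g e x *
      (metric g e j m x * metric g e k l x - metric g e j l x * metric g e k m x)
        / (((n : ℝ) - 1) * ((n : ℝ) - 2))

/-- `X` is a Chen vector of the Lorentzian manifold `(M, g)`: a smooth timelike vector field with
`∇_j X_k = ρ g_jk` in every chart, for some smooth scalar field `ρ`. A Lorentzian manifold with such
a vector field is a generalized Robertson-Walker space-time with Chen vector `X`. -/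
structure IsChenVector (X : ∀ p : M, TangentSpace (𝓡 n) p) : Prop where
  contMDiff : ContMDiff (𝓡 n) (𝓡 n).tangent ∞ (fun p ↦ (⟨p, X p⟩ : TangentBundle (𝓡 n) M))
  timelike : ∀ p : M, g.val p (X p) (X p) < 0
  concircular : ∃ ρ : M → ℝ, ContMDiff (𝓡 n) 𝓘(ℝ, ℝ) ∞ ρ ∧
    ∀ e ∈ atlas (EuclideanSpace ℝ (Fin n)) M, ∀ x ∈ e.target, ∀ j k : Fin n,
      covDeriv g X e j k x = ρ (e.symm x) * metric g e j k x

end Coordinates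

end

end GRW

namespace GRW

noncomputable section

section Smoothness

variable {n : ℕ} {M : Type*} [TopologicalSpace M] [ChartedSpace (EuclideanSpace ℝ (Fin n)) M]
  [IsManifold (𝓡 n) ∞ M]

variable {e : OpenPartialHomeomorph M (EuclideanSpace ℝ (Fin n))}

lemma contMDiffOn_atlas (he : e ∈ atlas (EuclideanSpace ℝ (Fin n)) M) :
    ContMDiffOn (𝓡 n) (𝓡 n) ∞ e e.source :=
  contMDiffOn_of_mem_maximalAtlas (IsManifold.subset_maximalAtlas he)

lemma contMDiffOn_atlas_symm (he : e ∈ atlas (EuclideanSpace ℝ (Fin n)) M) :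
    ContMDiffOn (𝓡 n) (𝓡 n) ∞ e.symm e.target :=
  contMDiffOn_symm_of_mem_maximalAtlas (IsManifold.subset_maximalAtlas he)

lemma contMDiffOn_frame (he : e ∈ atlas (EuclideanSpace ℝ (Fin n)) M) (i : Fin n) :
    ContMDiffOn (𝓡 n) (𝓡 n).tangent ∞
      (fun x ↦ (⟨e.symm x, frame e x i⟩ : TangentBundle (𝓡 n) M)) e.target := by
  have h := (contMDiffOn_atlas_symm he).contMDiffOn_tangentMapWithin (m := ∞) le_rfl
    e.open_target.uniqueMDiffOn
  have h2 : ContMDiff (𝓡 n) (𝓡 n).tangent ∞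
      (fun x ↦ (⟨x, EuclideanSpace.single i (1 : ℝ)⟩ :
        TangentBundle (𝓡 n) (EuclideanSpace ℝ (Fin n)))) :=
    (contMDiff_vectorSpace_iff_contDiff (𝕜 := ℝ) (E := EuclideanSpace ℝ (Fin n)) (n := ∞)
      (V := fun _ ↦ (EuclideanSpace.single i (1 : ℝ) : EuclideanSpace ℝ (Fin n)))).2 contDiff_const
  have h3 := h.comp (h2.contMDiffOn (s := e.target)) (fun x hx ↦ hx)
  refine h3.congr fun x hx ↦ ?_
  simp only [Function.comp, tangentMapWithin, frame]
  rw [mfderivWithin_of_isOpen e.open_target hx]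

lemma contDiffOn_metric (g : LorentzMetric n M) (he : e ∈ atlas (EuclideanSpace ℝ (Fin n)) M)
    (i j : Fin n) : ContDiffOn ℝ ∞ (metric g e i j) e.target := by
  rw [← contMDiffOn_iff_contDiffOn]
  have hg : ContMDiffOn (𝓡 n)
    ((𝓡 n).prod 𝓘(ℝ, EuclideanSpace ℝ (Fin n) →L[ℝ] EuclideanSpace ℝ (Fin n) →L[ℝ] ℝ)) ∞
    (fun x ↦ TotalSpace.mk'
      (EuclideanSpace ℝ (Fin n) →L[ℝ] EuclideanSpace ℝ (Fin n) →L[ℝ] ℝ)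
      (E := fun p : M ↦ TangentSpace (𝓡 n) p →L[ℝ] TangentSpace (𝓡 n) p →L[ℝ] ℝ)
      (e.symm x) (g.val (e.symm x))) e.target :=
    g.contMDiff.comp_contMDiffOn (contMDiffOn_atlas_symm he)
  have h : ContMDiffOn (𝓡 n) ((𝓡 n).prod 𝓘(ℝ, ℝ)) ∞
    (fun x ↦ TotalSpace.mk' ℝ (E := Bundle.Trivial M ℝ) (e.symm x) (metric g e i j x))
      e.target := by
    intro x hx
    exact ContMDiffWithinAt.clm_bundle_apply₂ (F₁ := EuclideanSpace ℝ (Fin n))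
      (F₂ := EuclideanSpace ℝ (Fin n)) (hg x hx) (contMDiffOn_frame he i x hx)
        (contMDiffOn_frame he j x hx)
  intro x hx
  have := h x hx
  rw [contMDiffWithinAt_totalSpace] at this
  exact this.2

lemma contDiffOn_upper {X : ∀ p : M, TangentSpace (𝓡 n) p}
    (hX : ContMDiff (𝓡 n) (𝓡 n).tangent ∞ (fun p ↦ (⟨p, X p⟩ : TangentBundle (𝓡 n) M)))
    (he : e ∈ atlas (EuclideanSpace ℝ (Fin n)) M) (i : Fin n) :
    ContDiffOn ℝ ∞ (upper X e i) e.target := by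
  have h := (contMDiffOn_atlas he).contMDiffOn_tangentMapWithin (m := ∞) le_rfl
    e.open_source.uniqueMDiffOn
  have h2 := hX.comp_contMDiffOn (contMDiffOn_atlas_symm he)
  have h3 := h.comp h2 (fun x hx ↦ e.map_target hx)
  have h4 := (contMDiff_snd_tangentBundle_modelSpace (n := ∞) (EuclideanSpace ℝ (Fin n))
    (𝓡 n)).comp_contMDiffOn h3
  have h5 := contMDiffOn_iff_contDiffOn.1 h4
  have h6 := (EuclideanSpace.proj (𝕜 := ℝ) i :
    EuclideanSpace ℝ (Fin n) →L[ℝ] ℝ).contDiff.comp_contDiffOn h5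
  refine h6.congr fun x hx ↦ ?_
  simp only [Function.comp, tangentMapWithin, upper]
  rw [mfderivWithin_of_isOpen e.open_source (e.map_target hx)]
  rfl

end Smoothness

section Bilinear

variable {n : ℕ} {M : Type*} [TopologicalSpace M] [ChartedSpace (EuclideanSpace ℝ (Fin n)) M]
  [IsManifold (𝓡 n) ∞ M]

variable {F : Type*} [NormedAddCommGroup F] [NormedSpace ℝ F]

/-- The bilinear map with prescribed values on pairs of standard basis vectors. -/
def bilin (a : Fin n → Fin n → F) :
    EuclideanSpace ℝ (Fin n) →L[ℝ] EuclideanSpace ℝ (Fin n) →L[ℝ] F :=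
  ∑ i, ∑ j, (EuclideanSpace.proj (𝕜 := ℝ) i).smulRight
    ((EuclideanSpace.proj (𝕜 := ℝ) j).smulRight (a i j))

lemma bilin_apply (a : Fin n → Fin n → F) (u v : EuclideanSpace ℝ (Fin n)) :
    bilin a u v = ∑ i, ∑ j, u i • v j • a i j := by
  simp [bilin]

@[simp]
lemma bilin_single (a : Fin n → Fin n → F) (i j : Fin n) :
    bilin a (EuclideanSpace.single i 1) (EuclideanSpace.single j 1) = a i j := by
  simp [bilin_apply, ite_smul, Finset.sum_ite_eq']

lemma eq_sum_single (u : EuclideanSpace ℝ (Fin n)) :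
    u = ∑ i, u i • EuclideanSpace.single i (1 : ℝ) := by
  ext j
  simp [Pi.single_apply]

lemma linearMap_apply_eq_sum (f : EuclideanSpace ℝ (Fin n) →ₗ[ℝ] F)
    (u : EuclideanSpace ℝ (Fin n)) : f u = ∑ i, u i • f (EuclideanSpace.single i 1) := by
  conv_lhs => rw [eq_sum_single u]
  simp

lemma contDiffOn_bilin {s : Set (EuclideanSpace ℝ (Fin n))}
    {a : Fin n → Fin n → EuclideanSpace ℝ (Fin n) → F} (h : ∀ i j, ContDiffOn ℝ ∞ (a i j) s) :
    ContDiffOn ℝ ∞ (fun x ↦ bilin fun i j ↦ a i j x) s := by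
  unfold bilin
  refine ContDiffOn.sum fun i _ ↦ ContDiffOn.sum fun j _ ↦ ?_
  exact contDiffOn_const.smulRight (contDiffOn_const.smulRight (h i j))

end Bilinear

section MatrixInverse

lemma contDiffOn_det {E ι : Type*} [NormedAddCommGroup E] [NormedSpace ℝ E] [Fintype ι]
    [DecidableEq ι] {s : Set E} {A : E → Matrix ι ι ℝ}
    (h : ∀ i j, ContDiffOn ℝ ∞ (fun x ↦ A x i j) s) : ContDiffOn ℝ ∞ (fun x ↦ (A x).det) s := by
  simp only [Matrix.det_apply']
  exact ContDiffOn.sum fun σ _ ↦ contDiffOn_const.mul (contDiffOn_prod fun i _ ↦ h _ _)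

lemma contDiffOn_matrix_inv {E ι : Type*} [NormedAddCommGroup E] [NormedSpace ℝ E] [Fintype ι]
    [DecidableEq ι] {s : Set E} {A : E → Matrix ι ι ℝ}
    (h : ∀ i j, ContDiffOn ℝ ∞ (fun x ↦ A x i j) s) (h0 : ∀ x ∈ s, (A x).det ≠ 0) (i j : ι) :
    ContDiffOn ℝ ∞ (fun x ↦ (A x)⁻¹ i j) s := by
  simp only [Matrix.inv_def, Ring.inverse_eq_inv', Matrix.smul_apply, Matrix.adjugate_apply,
    smul_eq_mul]
  refine ((contDiffOn_det h).inv h0).mul (contDiffOn_det fun k l ↦ ?_)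
  by_cases hk : k = j
  · subst hk
    simpa using contDiffOn_const
  · simpa [Matrix.updateRow_ne hk] using h k l

end MatrixInverse

section Pointwise

variable {n : ℕ} {M : Type*} [TopologicalSpace M] [ChartedSpace (EuclideanSpace ℝ (Fin n)) M]
  [IsManifold (𝓡 n) ∞ M]

variable (g : LorentzMetric n M) (e : OpenPartialHomeomorph M (EuclideanSpace ℝ (Fin n)))

/-- The differential of the inverse chart, as an endomorphism of the model space. -/
def dsymm (x : EuclideanSpace ℝ (Fin n)) :
    EuclideanSpace ℝ (Fin n) →L[ℝ] TangentSpace (𝓡 n) (e.symm x) :=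
  mfderiv (𝓡 n) (𝓡 n) e.symm x

/-- The metric in the chart `e`, as a field of bilinear forms. -/
def metricForm (x : EuclideanSpace ℝ (Fin n)) :
    EuclideanSpace ℝ (Fin n) →L[ℝ] EuclideanSpace ℝ (Fin n) →L[ℝ] ℝ :=
  bilin fun i j ↦ metric g e i j x

/-- The Christoffel symbols in the chart `e`, as a field of bilinear maps. -/
def christoffelMap (x : EuclideanSpace ℝ (Fin n)) :
    EuclideanSpace ℝ (Fin n) →L[ℝ] EuclideanSpace ℝ (Fin n) →L[ℝ] EuclideanSpace ℝ (Fin n) :=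
  bilin fun i j ↦ WithLp.toLp 2 fun k ↦ christoffel g e k i j x

/-- The vector of contravariant components of a vector field in the chart `e`. -/
def upperVec (X : ∀ p : M, TangentSpace (𝓡 n) p) (x : EuclideanSpace ℝ (Fin n)) :
    EuclideanSpace ℝ (Fin n) :=
  mfderiv (𝓡 n) (𝓡 n) e (e.symm x) (X (e.symm x))

lemma metricForm_single (x : EuclideanSpace ℝ (Fin n)) (i j : Fin n) :
    metricForm g e x (EuclideanSpace.single i 1) (EuclideanSpace.single j 1) = metric g e i j x :=
  bilin_single _ i j

lemma christoffelMap_single (x : EuclideanSpace ℝ (Fin n)) (i j k : Fin n) :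
    christoffelMap g e x (EuclideanSpace.single i 1) (EuclideanSpace.single j 1) k =
      christoffel g e k i j x := by
  simp [christoffelMap]

lemma metricForm_apply (x : EuclideanSpace ℝ (Fin n)) (u v : EuclideanSpace ℝ (Fin n)) :
    metricForm g e x u v = g.val (e.symm x) (dsymm e x u) (dsymm e x v) := by
  have h (i : Fin n) : g.val (e.symm x) (dsymm e x (EuclideanSpace.single i 1)) (dsymm e x v) =
      ∑ j, v j * metric g e i j x := by
    conv_lhs => rw [eq_sum_single v]
    rw [map_sum, map_sum]
    refine Finset.sum_congr rfl fun j _ ↦ ?_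
    rw [map_smul, map_smul]
    rfl
  conv_rhs => rw [eq_sum_single u]
  rw [metricForm, bilin_apply, map_sum, map_sum, sum_apply]
  refine Finset.sum_congr rfl fun i _ ↦ ?_
  rw [map_smul, map_smul, smul_apply, h, Finset.smul_sum]
  rfl

lemma metricForm_symm (x u v : EuclideanSpace ℝ (Fin n)) :
    metricForm g e x u v = metricForm g e x v u := by
  rw [metricForm_apply, metricForm_apply, g.symm]

lemma metric_symm (x : EuclideanSpace ℝ (Fin n)) (i j : Fin n) :
    metric g e i j x = metric g e j i x := g.symm _ _ _

lemma LorentzMetric.eq_zero_of_val_eq_zero {p : M} {v : TangentSpace (𝓡 n) p}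
    (h : ∀ w, g.val p v w = 0) : v = 0 := by
  obtain ⟨t, -, ht⟩ := g.signature p
  by_contra hv
  have := ht v (by rw [g.symm]; exact h t) hv
  rw [h v] at this
  exact lt_irrefl _ this

variable {e}

lemma dsymm_comp_mfderiv (he : e ∈ atlas (EuclideanSpace ℝ (Fin n)) M)
    {x : EuclideanSpace ℝ (Fin n)} (hx : x ∈ e.target) (v : TangentSpace (𝓡 n) (e.symm x)) :
    dsymm e x (mfderiv (𝓡 n) (𝓡 n) e (e.symm x) v) = v := by
  have hd : e.MDifferentiable (𝓡 n) (𝓡 n) := mdifferentiable_of_mem_atlas he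
  have := hd.symm_comp_deriv (e.map_target hx)
  rw [e.right_inv hx] at this
  exact DFunLike.congr_fun this v

lemma dsymm_injective (he : e ∈ atlas (EuclideanSpace ℝ (Fin n)) M)
    {x : EuclideanSpace ℝ (Fin n)} (hx : x ∈ e.target) : Function.Injective (dsymm e x) := by
  have hd : e.MDifferentiable (𝓡 n) (𝓡 n) := mdifferentiable_of_mem_atlas he
  exact hd.symm.mfderiv_injective hx

lemma dsymm_upperVec (he : e ∈ atlas (EuclideanSpace ℝ (Fin n)) M)
    {x : EuclideanSpace ℝ (Fin n)} (hx : x ∈ e.target) (X : ∀ p : M, TangentSpace (𝓡 n) p) :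
    dsymm e x (upperVec e X x) = X (e.symm x) :=
  dsymm_comp_mfderiv he hx _

lemma metricForm_upperVec (he : e ∈ atlas (EuclideanSpace ℝ (Fin n)) M)
    {x : EuclideanSpace ℝ (Fin n)} (hx : x ∈ e.target) (X : ∀ p : M, TangentSpace (𝓡 n) p) :
    metricForm g e x (upperVec e X x) (upperVec e X x) =
      g.val (e.symm x) (X (e.symm x)) (X (e.symm x)) := by
  rw [metricForm_apply, dsymm_upperVec he hx]

lemma metricForm_nondegenerate (he : e ∈ atlas (EuclideanSpace ℝ (Fin n)) M)
    {x : EuclideanSpace ℝ (Fin n)} (hx : x ∈ e.target) {u : EuclideanSpace ℝ (Fin n)}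
    (h : ∀ v, metricForm g e x u v = 0) : u = 0 := by
  refine dsymm_injective he hx ?_
  rw [map_zero]
  refine g.eq_zero_of_val_eq_zero fun w ↦ ?_
  let w' : EuclideanSpace ℝ (Fin n) := mfderiv (𝓡 n) (𝓡 n) e (e.symm x) w
  have hw : dsymm e x w' = w := dsymm_comp_mfderiv he hx w
  rw [← hw, ← metricForm_apply]
  exact h w'

lemma det_metric_ne_zero (he : e ∈ atlas (EuclideanSpace ℝ (Fin n)) M)
    {x : EuclideanSpace ℝ (Fin n)} (hx : x ∈ e.target) :
    (Matrix.of fun a b ↦ metric g e a b x).det ≠ 0 := by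
  intro h
  obtain ⟨v, hv, h0⟩ := Matrix.exists_mulVec_eq_zero_iff.2 h
  apply hv
  have : WithLp.toLp 2 v = (0 : EuclideanSpace ℝ (Fin n)) := by
    refine metricForm_nondegenerate g he hx fun w ↦ ?_
    rw [metricForm_symm, metricForm, bilin_apply]
    refine Finset.sum_eq_zero fun i _ ↦ ?_
    have := congrFun h0 i
    simp only [Matrix.mulVec, dotProduct, Matrix.of_apply, Pi.zero_apply] at this
    rw [← Finset.smul_sum]
    simp only [smul_eq_mul, mul_comm (v _)]
    rw [this, mul_zero]
  simpa using this

lemma sum_invMetric_mul_metric (he : e ∈ atlas (EuclideanSpace ℝ (Fin n)) M)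
    {x : EuclideanSpace ℝ (Fin n)} (hx : x ∈ e.target) (i j : Fin n) :
    ∑ k, invMetric g e i k x * metric g e k j x = if i = j then 1 else 0 := by
  have := Matrix.nonsing_inv_mul _ (isUnit_iff_ne_zero.2 (det_metric_ne_zero g he hx))
  have := congrFun (congrFun this i) j
  rw [Matrix.mul_apply, Matrix.one_apply] at this
  exact this

lemma sum_metric_mul_invMetric (he : e ∈ atlas (EuclideanSpace ℝ (Fin n)) M)
    {x : EuclideanSpace ℝ (Fin n)} (hx : x ∈ e.target) (i j : Fin n) :
    ∑ k, metric g e i k x * invMetric g e k j x = if i = j then 1 else 0 := by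
  have := Matrix.mul_nonsing_inv _ (isUnit_iff_ne_zero.2 (det_metric_ne_zero g he hx))
  have := congrFun (congrFun this i) j
  rw [Matrix.mul_apply, Matrix.one_apply] at this
  exact this

lemma invMetric_symm (i j : Fin n) (x : EuclideanSpace ℝ (Fin n)) :
    invMetric g e i j x = invMetric g e j i x := by
  have h : (Matrix.of fun a b ↦ metric g e a b x).IsSymm := by
    ext a b
    exact metric_symm g e x b a
  exact congrFun (congrFun h.inv j) i

end Pointwise

section CoordinateSmoothness

variable {n : ℕ} {M : Type*} [TopologicalSpace M] [ChartedSpace (EuclideanSpace ℝ (Fin n)) M]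
  [IsManifold (𝓡 n) ∞ M]

variable (g : LorentzMetric n M) {e : OpenPartialHomeomorph M (EuclideanSpace ℝ (Fin n))}
  (he : e ∈ atlas (EuclideanSpace ℝ (Fin n)) M)

lemma contDiffOn_pd {s : Set (EuclideanSpace ℝ (Fin n))} (hs : IsOpen s)
    {f : EuclideanSpace ℝ (Fin n) → ℝ} (hf : ContDiffOn ℝ ∞ f s) (i : Fin n) :
    ContDiffOn ℝ ∞ (pd i f) s :=
  (hf.fderiv_of_isOpen hs (m := ∞) le_rfl).clm_apply contDiffOn_const

include he

lemma contDiffOn_invMetric (i j : Fin n) : ContDiffOn ℝ ∞ (invMetric g e i j) e.target :=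
  contDiffOn_matrix_inv (fun i j ↦ contDiffOn_metric g he i j)
    (fun _ hx ↦ det_metric_ne_zero g he hx) i j

lemma contDiffOn_christoffel (k i j : Fin n) :
    ContDiffOn ℝ ∞ (christoffel g e k i j) e.target := by
  have h (a b c) := contDiffOn_pd e.open_target (contDiffOn_metric g he a b) c
  exact contDiffOn_const.mul (ContDiffOn.sum fun l _ ↦
    (contDiffOn_invMetric g he k l).mul (((h _ _ _).add (h _ _ _)).sub (h _ _ _)))

lemma contDiffOn_riemannUp (i j k m : Fin n) :
    ContDiffOn ℝ ∞ (riemannUp g e i j k m) e.target := by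
  have h (a b c) := contDiffOn_christoffel g he a b c
  have h' (a b c d) := contDiffOn_pd e.open_target (h a b c) d
  exact ((h' _ _ _ _).sub (h' _ _ _ _)).add (ContDiffOn.sum fun l _ ↦
    ((h _ _ _).mul (h _ _ _)).sub ((h _ _ _).mul (h _ _ _)))

lemma contDiffOn_ricci (j l : Fin n) : ContDiffOn ℝ ∞ (ricci g e j l) e.target :=
  ContDiffOn.sum fun k _ ↦ ContDiffOn.sum fun m _ ↦ (contDiffOn_invMetric g he k m).mul
    (ContDiffOn.sum fun i _ ↦ (contDiffOn_riemannUp g he j k l i).mul (contDiffOn_metric g he i m))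

lemma contDiffOn_scalarCurv : ContDiffOn ℝ ∞ (scalarCurv g e) e.target :=
  ContDiffOn.sum fun k _ ↦ ContDiffOn.sum fun m _ ↦ (contDiffOn_invMetric g he k m).mul
    (contDiffOn_ricci g he k m)

lemma contDiffOn_metricForm : ContDiffOn ℝ ∞ (metricForm g e) e.target :=
  contDiffOn_bilin fun i j ↦ contDiffOn_metric g he i j

lemma contDiffOn_christoffelMap : ContDiffOn ℝ ∞ (christoffelMap g e) e.target := by
  refine contDiffOn_bilin fun i j ↦ ?_
  rw [contDiffOn_euclidean]
  exact fun k ↦ contDiffOn_christoffel g he k i j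

lemma contDiffOn_upperVec {X : ∀ p : M, TangentSpace (𝓡 n) p}
    (hX : ContMDiff (𝓡 n) (𝓡 n).tangent ∞ (fun p ↦ (⟨p, X p⟩ : TangentBundle (𝓡 n) M))) :
    ContDiffOn ℝ ∞ (upperVec e X) e.target := by
  rw [contDiffOn_euclidean]
  exact contDiffOn_upper hX he

end CoordinateSmoothness

section LocalGeometry

open Filter Topology

set_option synthInstance.maxHeartbeats 400000
set_option maxHeartbeats 1000000

variable {E F F' K : Type*} [NormedAddCommGroup E] [NormedSpace ℝ E] [NormedAddCommGroup F]
  [NormedSpace ℝ F] [NormedAddCommGroup F'] [NormedSpace ℝ F'] [NormedAddCommGroup K]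
  [NormedSpace ℝ K]

lemma fderiv_bilinear_apply {T : E → F →L[ℝ] F' →L[ℝ] K} {a : E → F} {b : E → F'} {x : E}
    (hT : DifferentiableAt ℝ T x) (ha : DifferentiableAt ℝ a x) (hb : DifferentiableAt ℝ b x)
    (w : E) : fderiv ℝ (fun y ↦ T y (a y) (b y)) x w =
      fderiv ℝ T x w (a x) (b x) + T x (fderiv ℝ a x w) (b x) + T x (a x) (fderiv ℝ b x w) := by
  have h := (hT.hasFDerivAt.clm_apply ha.hasFDerivAt).clm_apply hb.hasFDerivAt
  rw [h.fderiv]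
  simp
  abel

lemma fderiv_linear_apply {T : E → F →L[ℝ] K} {a : E → F} {x : E}
    (hT : DifferentiableAt ℝ T x) (ha : DifferentiableAt ℝ a x) (w : E) :
    fderiv ℝ (fun y ↦ T y (a y)) x w = fderiv ℝ T x w (a x) + T x (fderiv ℝ a x w) := by
  rw [(hT.hasFDerivAt.clm_apply ha.hasFDerivAt).fderiv]
  simp
  abel

lemma fderiv_bilinear_const {T : E → F →L[ℝ] F' →L[ℝ] K} {x : E}
    (hT : DifferentiableAt ℝ T x) (a : F) (b : F') (w : E) :
    fderiv ℝ (fun y ↦ T y a b) x w = fderiv ℝ T x w a b := by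
  rw [fderiv_bilinear_apply hT (differentiableAt_const a) (differentiableAt_const b)]
  simp

lemma fderiv_linear_const {T : E → F →L[ℝ] K} {x : E}
    (hT : DifferentiableAt ℝ T x) (a : F) (w : E) :
    fderiv ℝ (fun y ↦ T y a) x w = fderiv ℝ T x w a := by
  rw [fderiv_linear_apply hT (differentiableAt_const a)]
  simp

lemma fderiv_apply_congr {f h : E → K} {x : E} (hfh : f =ᶠ[𝓝 x] h) (v : E) :
    fderiv ℝ f x v = fderiv ℝ h x v := by rw [hfh.fderiv_eq]

lemma differentiableAt_comp_bilinear {E' : Type*} [NormedAddCommGroup E'] [NormedSpace ℝ E']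
    {T : E' → F →L[ℝ] F' →L[ℝ] K} {φ : E → E'} {x : E} (hT : DifferentiableAt ℝ T (φ x))
    (hφ : DifferentiableAt ℝ φ x) : DifferentiableAt ℝ (fun y ↦ T (φ y)) x :=
  DifferentiableAt.fun_comp' (g := T) (f := φ) x hT hφ

lemma fderiv_comp_bilinear {E' : Type*} [NormedAddCommGroup E'] [NormedSpace ℝ E']
    {T : E' → F →L[ℝ] F' →L[ℝ] K} {φ : E → E'} {x : E} (hT : DifferentiableAt ℝ T (φ x))
    (hφ : DifferentiableAt ℝ φ x) (w : E) :
    fderiv ℝ (fun y ↦ T (φ y)) x w = fderiv ℝ T (φ x) (fderiv ℝ φ x w) := by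
  rw [fderiv_fun_comp (g := T) (f := φ) x hT hφ]
  rfl

/-- The second derivative of `f` at `x`, first in the direction `v` and then in the direction `u`. -/
def secondDeriv (f : E → K) (x u v : E) : K :=
  fderiv ℝ (fun y ↦ fderiv ℝ f y v) x u

lemma differentiableAt_fderiv {f : E → K} {x : E} (hf : ContDiffAt ℝ 2 f x) :
    DifferentiableAt ℝ (fderiv ℝ f) x :=
  (hf.fderiv_right (m := 1) (by norm_num)).differentiableAt (by norm_num)

lemma differentiableAt_fderiv_apply {f : E → K} {x : E} (hf : ContDiffAt ℝ 2 f x) (u : E) :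
    DifferentiableAt ℝ (fun y ↦ fderiv ℝ f y u) x :=
  (differentiableAt_fderiv hf).clm_apply (differentiableAt_const u)

lemma secondDeriv_symm {f : E → K} {x : E} (hf : ContDiffAt ℝ 2 f x) (u v : E) :
    secondDeriv f x u v = secondDeriv f x v u := by
  rw [secondDeriv, secondDeriv, fderiv_linear_const (differentiableAt_fderiv hf),
    fderiv_linear_const (differentiableAt_fderiv hf)]
  exact (hf.isSymmSndFDerivAt (by simp)).eq u v

lemma differentiableAt_bilinear_const {T : E → F →L[ℝ] F' →L[ℝ] K} {x : E}
    (hT : DifferentiableAt ℝ T x) (a : F) (b : F') : DifferentiableAt ℝ (fun y ↦ T y a b) x :=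
  (hT.clm_apply (differentiableAt_const a)).clm_apply (differentiableAt_const b)

/-- The curvature `R(u, v) w` of the connection with Christoffel map `Γ`. -/
def curv (Γ : E → E →L[ℝ] E →L[ℝ] E) (x u v w : E) : E :=
  fderiv ℝ Γ x v u w - fderiv ℝ Γ x u v w + (Γ x v (Γ x u w) - Γ x u (Γ x v w))

/-- Metric compatibility makes the curvature skew-symmetric with respect to the metric. -/
lemma curv_skew {G : E → E →L[ℝ] E →L[ℝ] ℝ} {Γ : E → E →L[ℝ] E →L[ℝ] E} {x : E}
    (hG : ContDiffAt ℝ 2 G x) (hΓ : DifferentiableAt ℝ Γ x)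
    (hc : ∀ᶠ y in 𝓝 x, ∀ u v w, fderiv ℝ G y u v w = G y (Γ y u v) w + G y v (Γ y u w))
    (u v w z : E) : G x (curv Γ x u v w) z + G x w (curv Γ x u v z) = 0 := by
  have hGd := hG.differentiableAt (by norm_num)
  have hd (a b : E) : DifferentiableAt ℝ (fun y ↦ Γ y a b) x :=
    differentiableAt_bilinear_const hΓ a b
  have key (u v : E) : secondDeriv G x v u w z =
      fderiv ℝ G x v (Γ x u w) z + G x (fderiv ℝ Γ x v u w) z
        + (fderiv ℝ G x v w (Γ x u z) + G x w (fderiv ℝ Γ x v u z)) := by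
    have h : (fun y ↦ fderiv ℝ G y u w z) =ᶠ[𝓝 x]
        fun y ↦ G y (Γ y u w) z + G y w (Γ y u z) := hc.mono fun y hy ↦ hy u w z
    have h1 := fderiv_apply_congr h v
    rw [fderiv_fun_add ((hGd.clm_apply (hd _ _)).clm_apply (differentiableAt_const z))
      ((hGd.clm_apply (differentiableAt_const w)).clm_apply (hd _ _)), add_apply,
      fderiv_bilinear_apply hGd (hd _ _) (differentiableAt_const z),
      fderiv_bilinear_apply hGd (differentiableAt_const w) (hd _ _),
      fderiv_bilinear_const hΓ, fderiv_bilinear_const hΓ] at h1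
    rw [fderiv_bilinear_const (differentiableAt_fderiv_apply hG u)] at h1
    rw [secondDeriv, h1]
    simp
  have h0 := hc.self_of_nhds
  have k1 := key u v
  have k2 := key v u
  rw [secondDeriv_symm hG, k2] at k1
  simp only [h0] at k1
  simp only [curv, map_add, map_sub, add_apply, sub_apply]
  linarith

/-- The Ricci identity for a covector field `η` with `∇η = ρ G`. -/
lemma curv_concircular {G : E → E →L[ℝ] E →L[ℝ] ℝ} {Γ : E → E →L[ℝ] E →L[ℝ] E}
    {η : E → E →L[ℝ] ℝ} {ρ : E → ℝ} {x : E}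
    (hG : DifferentiableAt ℝ G x) (hΓ : DifferentiableAt ℝ Γ x)
    (hη : ContDiffAt ℝ 2 η x) (hρ : DifferentiableAt ℝ ρ x)
    (hs : ∀ u v, Γ x u v = Γ x v u)
    (hc : ∀ u v w, fderiv ℝ G x u v w = G x (Γ x u v) w + G x v (Γ x u w))
    (hcc : ∀ᶠ y in 𝓝 x, ∀ u v, fderiv ℝ η y u v = η y (Γ y u v) + ρ y * G y u v)
    (u v w : E) :
    η x (curv Γ x u v w) = fderiv ℝ ρ x u * G x v w - fderiv ℝ ρ x v * G x u w := by
  have hηd := hη.differentiableAt (by norm_num)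
  have hd (a b : E) : DifferentiableAt ℝ (fun y ↦ Γ y a b) x :=
    differentiableAt_bilinear_const hΓ a b
  have hGd (a b : E) : DifferentiableAt ℝ (fun y ↦ G y a b) x :=
    differentiableAt_bilinear_const hG a b
  have key (u v : E) : secondDeriv η x v u w =
      fderiv ℝ η x v (Γ x u w) + η x (fderiv ℝ Γ x v u w)
        + (ρ x * fderiv ℝ G x v u w + G x u w * fderiv ℝ ρ x v) := by
    have h : (fun y ↦ fderiv ℝ η y u w) =ᶠ[𝓝 x]
        fun y ↦ η y (Γ y u w) + ρ y * G y u w := hcc.mono fun y hy ↦ hy u w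
    have h1 := fderiv_apply_congr h v
    rw [fderiv_fun_add (hηd.clm_apply (hd _ _)) (hρ.fun_mul (hGd _ _)), add_apply,
      fderiv_linear_apply hηd (hd _ _), fderiv_fun_mul hρ (hGd _ _), add_apply, smul_apply,
      smul_apply, fderiv_bilinear_const hG, fderiv_bilinear_const hΓ,
      fderiv_linear_const (differentiableAt_fderiv_apply hη u)] at h1
    rw [secondDeriv, h1]
    simp
  have h0 := hcc.self_of_nhds
  have k1 := key u v
  have k2 := key v u
  rw [secondDeriv_symm hη, k2] at k1
  simp only [h0, hc] at k1
  simp only [curv, map_add, map_sub]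
  have e1 := hs u v
  rw [e1] at k1
  linear_combination -k1

/-- The Koszul formula determines the Christoffel map and its transformation law. -/
lemma christoffel_transform {G : F → F →L[ℝ] F →L[ℝ] ℝ} {Γ : F → F →L[ℝ] F →L[ℝ] F}
    {G' : E → E →L[ℝ] E →L[ℝ] ℝ} {Γ' : E → E →L[ℝ] E →L[ℝ] E} {φ : E → F} {x : E}
    (hφ : ContDiffAt ℝ 2 φ x) (hG : DifferentiableAt ℝ G (φ x)) (hG' : DifferentiableAt ℝ G' x)
    (hGs : ∀ u v, G (φ x) u v = G (φ x) v u)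
    (hnd : ∀ u, (∀ v, G (φ x) u v = 0) → u = 0) (hsurj : Function.Surjective (fderiv ℝ φ x))
    (hpull : ∀ᶠ y in 𝓝 x, ∀ u v, G' y u v = G (φ y) (fderiv ℝ φ y u) (fderiv ℝ φ y v))
    (hk : ∀ u v w, 2 * G (φ x) (Γ (φ x) u v) w =
      fderiv ℝ G (φ x) u v w + fderiv ℝ G (φ x) v u w - fderiv ℝ G (φ x) w u v)
    (hk' : ∀ u v w, 2 * G' x (Γ' x u v) w =
      fderiv ℝ G' x u v w + fderiv ℝ G' x v u w - fderiv ℝ G' x w u v) (u v : E) :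
    fderiv ℝ φ x (Γ' x u v) =
      secondDeriv φ x u v + Γ (φ x) (fderiv ℝ φ x u) (fderiv ℝ φ x v) := by
  have hφ1 := hφ.differentiableAt (by norm_num)
  have hφ2 := differentiableAt_fderiv_apply hφ
  have key (w u v : E) : fderiv ℝ G' x w u v =
      fderiv ℝ G (φ x) (fderiv ℝ φ x w) (fderiv ℝ φ x u) (fderiv ℝ φ x v)
        + G (φ x) (secondDeriv φ x w u) (fderiv ℝ φ x v)
        + G (φ x) (fderiv ℝ φ x u) (secondDeriv φ x w v) := by
    have h : (fun y ↦ G' y u v) =ᶠ[𝓝 x]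
        fun y ↦ G (φ y) (fderiv ℝ φ y u) (fderiv ℝ φ y v) := hpull.mono fun y hy ↦ hy u v
    have h1 := fderiv_apply_congr h w
    rw [fderiv_bilinear_const hG', fderiv_bilinear_apply (differentiableAt_comp_bilinear hG hφ1) (hφ2 u) (hφ2 v),
      fderiv_comp_bilinear hG hφ1] at h1
    exact h1
  refine sub_eq_zero.1 (hnd _ fun z ↦ ?_)
  obtain ⟨w, rfl⟩ := hsurj z
  have h1 := hk' u v w
  rw [hpull.self_of_nhds, key, key, key] at h1
  have h2 := hk (fderiv ℝ φ x u) (fderiv ℝ φ x v) (fderiv ℝ φ x w)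
  simp only [map_add, map_sub, add_apply, sub_apply]
  rw [secondDeriv_symm hφ v u, secondDeriv_symm hφ w u, secondDeriv_symm hφ w v] at h1
  rw [hGs (secondDeriv φ x u w)] at h1
  linarith

/-- The transformation law of the curvature under a change of coordinates. -/
lemma curv_transform {Γ : F → F →L[ℝ] F →L[ℝ] F} {Γ' : E → E →L[ℝ] E →L[ℝ] E}
    {φ : E → F} {x : E} (hφ : ContDiffAt ℝ 3 φ x)
    (hΓ : DifferentiableAt ℝ Γ (φ x)) (hΓ' : DifferentiableAt ℝ Γ' x)
    (h : ∀ᶠ y in 𝓝 x, ∀ u v, fderiv ℝ φ y (Γ' y u v) =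
      secondDeriv φ y u v + Γ (φ y) (fderiv ℝ φ y u) (fderiv ℝ φ y v)) (u v w : E) :
    fderiv ℝ φ x (curv Γ' x u v w) =
      curv Γ (φ x) (fderiv ℝ φ x u) (fderiv ℝ φ x v) (fderiv ℝ φ x w) := by
  have hφ' : ContDiffAt ℝ 2 (fun y ↦ fderiv ℝ φ y w) x :=
    (hφ.fderiv_right (m := 2) (by norm_num)).clm_apply contDiffAt_const
  have hφ1 := hφ.differentiableAt (by norm_num)
  have hφ2 : ContDiffAt ℝ 2 φ x := hφ.of_le (by norm_num)
  have hd2 := differentiableAt_fderiv_apply hφ2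
  have hd (a b : E) : DifferentiableAt ℝ (fun y ↦ Γ' y a b) x :=
    differentiableAt_bilinear_const hΓ' a b
  have hd3 : DifferentiableAt ℝ (fun y ↦ Γ (φ y)) x := differentiableAt_comp_bilinear hΓ hφ1
  have hd4 (a : E) : DifferentiableAt ℝ (fun y ↦ secondDeriv φ y a w) x :=
    differentiableAt_fderiv_apply hφ' a
  have key (u v : E) : secondDeriv φ x v (Γ' x u w) + fderiv ℝ φ x (fderiv ℝ Γ' x v u w) =
      secondDeriv (fun y ↦ fderiv ℝ φ y w) x v u
        + (fderiv ℝ Γ (φ x) (fderiv ℝ φ x v) (fderiv ℝ φ x u) (fderiv ℝ φ x w)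
          + Γ (φ x) (secondDeriv φ x v u) (fderiv ℝ φ x w)
          + Γ (φ x) (fderiv ℝ φ x u) (secondDeriv φ x v w)) := by
    have h' : (fun y ↦ fderiv ℝ φ y (Γ' y u w)) =ᶠ[𝓝 x] fun y ↦ secondDeriv φ y u w
        + Γ (φ y) (fderiv ℝ φ y u) (fderiv ℝ φ y w) := h.mono fun y hy ↦ hy u w
    have h1 := fderiv_apply_congr h' v
    rw [fderiv_linear_apply (differentiableAt_fderiv hφ2) (hd _ _), fderiv_bilinear_const hΓ',
      fderiv_fun_add (hd4 u) ((hd3.clm_apply (hd2 u)).clm_apply (hd2 w)), add_apply,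
      fderiv_bilinear_apply hd3 (hd2 u) (hd2 w), fderiv_comp_bilinear hΓ hφ1,
      ← fderiv_linear_const (differentiableAt_fderiv hφ2)] at h1
    exact h1
  have h0 := h.self_of_nhds
  have h4 (a b : E) := eq_sub_of_add_eq (h0 a b).symm
  have k1 := eq_sub_of_add_eq' (key u v)
  have k2 := eq_sub_of_add_eq' (key v u)
  rw [secondDeriv_symm hφ' u v, secondDeriv_symm hφ2 u v] at k2
  simp only [curv, map_add, map_sub, k1, k2]
  rw [h4 v (Γ' x u w), h4 u (Γ' x v w), h4 u w, h4 v w]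
  simp only [map_sub]
  abel

end LocalGeometry

section CurvatureAlgebra

variable {n : ℕ} {g h : Fin n → Fin n → ℝ} {Rm : Fin n → Fin n → Fin n → Fin n → ℝ}
  {ric : Fin n → Fin n → ℝ} {sc N : ℝ} {U X d : Fin n → ℝ}

lemma sum_symm_mul_skew {h T : Fin n → Fin n → ℝ} (hs : ∀ i j, h i j = h j i)
    (hT : ∀ i j, T i j = -T j i) : ∑ i, ∑ j, h i j * T i j = 0 := by
  have : ∑ i, ∑ j, h i j * T i j = -∑ i, ∑ j, h i j * T i j := by
    conv_lhs => rw [Finset.sum_comm]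
    simp only [← Finset.sum_neg_distrib]
    exact Finset.sum_congr rfl fun i _ ↦ Finset.sum_congr rfl fun j _ ↦ by rw [hs, hT]; ring
  linarith

lemma ric_symm (hs : ∀ i j, h i j = h j i) (a1 : ∀ i j k m, Rm i j k m = -Rm j i k m)
    (a2 : ∀ i j k m, Rm i j k m = -Rm i j m k)
    (b : ∀ i j k m, Rm i j k m + Rm j k i m + Rm k i j m = 0)
    (hric : ∀ j l, ric j l = ∑ k, ∑ m, h k m * Rm j k l m) (j l : Fin n) :
    ric j l = ric l j := by
  have h0 : ∑ k, ∑ m, h k m * Rm l j k m = 0 := sum_symm_mul_skew hs fun k m ↦ a2 l j k m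
  have h1 : ric j l - ric l j = -∑ k, ∑ m, h k m * Rm l j k m := by
    simp only [hric, ← Finset.sum_sub_distrib, ← Finset.sum_neg_distrib]
    refine Finset.sum_congr rfl fun k _ ↦ Finset.sum_congr rfl fun m _ ↦ ?_
    linear_combination h k m * b j k l m - h k m * a1 l k j m
  rw [h0] at h1
  linarith

lemma gradient_parallel (hX : ∀ k, X k = ∑ l, g k l * U l)
    (a2 : ∀ i j k m, Rm i j k m = -Rm i j m k)
    (c : ∀ i j k, ∑ m, Rm i j k m * U m = d i * g j k - d j * g i k) (i j : Fin n) :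
    d i * X j = d j * X i := by
  have h0 : ∑ k, ∑ m, (U k * U m) * Rm i j k m = 0 :=
    sum_symm_mul_skew (fun k m ↦ mul_comm _ _) fun k m ↦ a2 i j k m
  have h1 : ∑ k, ∑ m, (U k * U m) * Rm i j k m = d i * X j - d j * X i := by
    simp only [hX, Finset.mul_sum, ← Finset.sum_sub_distrib]
    refine Finset.sum_congr rfl fun k _ ↦ ?_
    have := c i j k
    calc ∑ m, (U k * U m) * Rm i j k m = U k * ∑ m, Rm i j k m * U m := by
          rw [Finset.mul_sum]; exact Finset.sum_congr rfl fun m _ ↦ by ring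
      _ = _ := by rw [this]; ring
  linarith

lemma ric_contract (gs : ∀ i j, g i j = g j i)
    (hg : ∀ i j, ∑ k, h i k * g k j = if i = j then 1 else 0)
    (a2 : ∀ i j k m, Rm i j k m = -Rm i j m k)
    (hric : ∀ j l, ric j l = ∑ k, ∑ m, h k m * Rm j k l m)
    (c : ∀ i j k, ∑ m, Rm i j k m * U m = d i * g j k - d j * g i k) (j : Fin n) :
    ∑ l, ric j l * U l = -((n : ℝ) - 1) * d j := by
  have h1 : ∑ l, ric j l * U l = ∑ k, ∑ m, h k m * (d k * g j m - d j * g k m) := by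
    simp only [hric, Finset.sum_mul]
    rw [Finset.sum_comm]
    refine Finset.sum_congr rfl fun k _ ↦ ?_
    rw [Finset.sum_comm]
    refine Finset.sum_congr rfl fun m _ ↦ ?_
    have := c j k m
    calc ∑ l, h k m * Rm j k l m * U l = -(h k m * ∑ l, Rm j k m l * U l) := by
          rw [Finset.mul_sum, ← Finset.sum_neg_distrib]
          exact Finset.sum_congr rfl fun l _ ↦ by rw [a2]; ring
      _ = _ := by rw [this]; ring
  have h2 (k : Fin n) : ∑ m, h k m * (d k * g j m - d j * g k m) =
      d k * (if k = j then 1 else 0) - d j := by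
    rw [← hg k j]
    have h3 := hg k k
    rw [if_pos rfl] at h3
    calc _ = d k * ∑ m, h k m * g m j - d j * ∑ m, h k m * g m k := by
          simp only [Finset.mul_sum, ← Finset.sum_sub_distrib]
          exact Finset.sum_congr rfl fun m _ ↦ by rw [gs j m, gs k m]; ring
      _ = _ := by rw [h3, mul_one]
  rw [h1, Finset.sum_congr rfl fun k _ ↦ h2 k, Finset.sum_sub_distrib]
  simp
  ring

lemma raise_lower (hX : ∀ k, X k = ∑ l, g k l * U l)
    (hg : ∀ i j, ∑ k, h i k * g k j = if i = j then 1 else 0) (j : Fin n) :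
    ∑ l, h j l * X l = U j := by
  simp only [hX, Finset.mul_sum]
  rw [Finset.sum_comm]
  simp only [← mul_assoc, ← Finset.sum_mul, hg]
  simp

/-- The coefficients of a perfect-fluid Ricci tensor are determined by the curvature scalar and
by the value of the Ricci tensor on the distinguished vector. -/
lemma perfectFluid_coefficients (hn : 3 ≤ n) (gs : ∀ i j, g i j = g j i)
    (hg : ∀ i j, ∑ k, h i k * g k j = if i = j then 1 else 0)
    (hsc : sc = ∑ j, ∑ l, h j l * ric j l)
    (hX : ∀ k, X k = ∑ l, g k l * U l) (hN : N = ∑ k, X k * U k) (hN0 : N ≠ 0) {α β : ℝ}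
    (hab : ∀ j k, ric j k = α * g j k + β * (X j * X k / N)) :
    α = (sc - (∑ j, ∑ k, ric j k * U j * U k) / N) / ((n : ℝ) - 1) ∧
      β = (n * ((∑ j, ∑ k, ric j k * U j * U k) / N) - sc) / ((n : ℝ) - 1) := by
  have hn1 : (n : ℝ) - 1 ≠ 0 := by
    have : (3 : ℝ) ≤ n := by exact_mod_cast hn
    linarith
  have h1 : ∑ j, ∑ k, ric j k * U j * U k = (α + β) * N := by
    have (j : Fin n) : ∑ k, ric j k * U j * U k = (α + β) * (X j * U j) := by
      calc _ = α * U j * ∑ k, g j k * U k + β * X j * U j * (∑ k, X k * U k) / N := by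
            rw [Finset.mul_sum, Finset.mul_sum, Finset.sum_div, ← Finset.sum_add_distrib]
            exact Finset.sum_congr rfl fun k _ ↦ by rw [hab]; ring
        _ = _ := by rw [← hX, ← hN]; field_simp
    rw [Finset.sum_congr rfl fun j _ ↦ this j, ← Finset.mul_sum, ← hN]
  have h2 : sc = n * α + β := by
    have (j : Fin n) : ∑ l, h j l * ric j l = α + β * (X j * U j) / N := by
      have h3 := hg j j
      rw [if_pos rfl] at h3
      calc _ = α * ∑ l, h j l * g l j + β * X j * (∑ l, h j l * X l) / N := by
            rw [Finset.mul_sum, Finset.mul_sum, Finset.sum_div, ← Finset.sum_add_distrib]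
            exact Finset.sum_congr rfl fun k _ ↦ by rw [hab, gs j]; ring
        _ = _ := by rw [h3, raise_lower hX hg]; ring
    rw [hsc, Finset.sum_congr rfl fun j _ ↦ this j, Finset.sum_add_distrib, ← Finset.sum_div,
      ← Finset.mul_sum, ← hN]
    simp
    field_simp
  rw [h1, h2]
  constructor <;> field_simp <;> ring

/-- The algebraic core: at a point where the curvature satisfies the integrability condition of a
concircular vector, the Weyl tensor annihilates the vector iff the Ricci tensor has the
perfect-fluid form. -/
lemma weyl_contract_eq_zero_iff (hn : 3 ≤ n) (gs : ∀ i j, g i j = g j i)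
    (hs : ∀ i j, h i j = h j i)
    (hg : ∀ i j, ∑ k, h i k * g k j = if i = j then 1 else 0)
    (a1 : ∀ i j k m, Rm i j k m = -Rm j i k m)
    (a2 : ∀ i j k m, Rm i j k m = -Rm i j m k)
    (b : ∀ i j k m, Rm i j k m + Rm j k i m + Rm k i j m = 0)
    (hric : ∀ j l, ric j l = ∑ k, ∑ m, h k m * Rm j k l m)
    (c : ∀ i j k, ∑ m, Rm i j k m * U m = d i * g j k - d j * g i k)
    (hX : ∀ k, X k = ∑ l, g k l * U l) (hN : N = ∑ k, X k * U k) (hN0 : N ≠ 0) :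
    (∀ j k l, ∑ m, (Rm j k l m + 1 / ((n : ℝ) - 2) *
        (g j m * ric k l - g k m * ric j l + ric j m * g k l - ric k m * g j l)
          - sc * (g j m * g k l - g j l * g k m) / (((n : ℝ) - 1) * ((n : ℝ) - 2))) * U m = 0) ↔
      ∀ j k, ric j k =
        (sc - (∑ j, ∑ k, ric j k * U j * U k) / N) / ((n : ℝ) - 1) * g j k +
        (n * ((∑ j, ∑ k, ric j k * U j * U k) / N) - sc) / ((n : ℝ) - 1) * (X j * X k / N) := by
  have hn3 : (3 : ℝ) ≤ n := by exact_mod_cast hn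
  have hn1 : (n : ℝ) - 1 ≠ 0 := by linarith
  have hn2 : (n : ℝ) - 2 ≠ 0 := by linarith
  set r := (∑ j, ∑ k, ric j k * U j * U k) / N with hr
  have hC := ric_contract gs hg a2 hric c
  have hB := gradient_parallel hX a2 c
  have hric_symm := ric_symm hs a1 a2 b hric
  have hd (j : Fin n) : d j = (∑ k, d k * U k) / N * X j := by
    rw [div_mul_eq_mul_div, eq_div_iff hN0, hN, Finset.mul_sum, Finset.sum_mul]
    exact Finset.sum_congr rfl fun k _ ↦ by linear_combination U k * hB j k
  have hrd : r = -((n : ℝ) - 1) * ((∑ k, d k * U k) / N) := by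
    rw [hr]
    have (j : Fin n) : ∑ k, ric j k * U j * U k = -((n : ℝ) - 1) * (d j * U j) := by
      rw [← mul_assoc, ← hC, Finset.sum_mul]
      exact Finset.sum_congr rfl fun k _ ↦ by ring
    rw [Finset.sum_congr rfl fun j _ ↦ this j, ← Finset.mul_sum, mul_div_assoc]
  have hd' (j : Fin n) : d j = -r / ((n : ℝ) - 1) * X j := by
    rw [hd j, hrd]; field_simp
  have hC' (j : Fin n) : ∑ l, ric j l * U l = r * X j := by
    rw [hC, hd' j]; field_simp
  have hW (j k l : Fin n) : ∑ m, (Rm j k l m + 1 / ((n : ℝ) - 2) *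
        (g j m * ric k l - g k m * ric j l + ric j m * g k l - ric k m * g j l)
          - sc * (g j m * g k l - g j l * g k m) / (((n : ℝ) - 1) * ((n : ℝ) - 2))) * U m =
      1 / ((n : ℝ) - 2) * (X j * (ric k l - (sc - r) / ((n : ℝ) - 1) * g k l)
        - X k * (ric j l - (sc - r) / ((n : ℝ) - 1) * g j l)) := by
    calc _ = ∑ m, Rm j k l m * U m + 1 / ((n : ℝ) - 2) *
        ((∑ m, g j m * U m) * ric k l - (∑ m, g k m * U m) * ric j l
          + (∑ m, ric j m * U m) * g k l - (∑ m, ric k m * U m) * g j l)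
          - sc * ((∑ m, g j m * U m) * g k l - g j l * ∑ m, g k m * U m)
            / (((n : ℝ) - 1) * ((n : ℝ) - 2)) := by
          simp only [Finset.sum_mul, Finset.mul_sum, Finset.sum_div, ← Finset.sum_sub_distrib,
            ← Finset.sum_add_distrib]
          exact Finset.sum_congr rfl fun m _ ↦ by ring
      _ = _ := by
          rw [c, ← hX, ← hX, hC', hC', hd' j, hd' k]
          field_simp
          ring
  simp only [hW]
  constructor
  · intro h0 k l
    have h1 (j : Fin n) : X j * U j * (ric k l - (sc - r) / ((n : ℝ) - 1) * g k l) =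
        X k * (ric l j * U j - (sc - r) / ((n : ℝ) - 1) * (g l j * U j)) := by
      have := (mul_eq_zero.1 (h0 j k l)).resolve_left (one_div_ne_zero hn2)
      rw [hric_symm l j, gs l j]
      linear_combination U j * this
    have h2 := Finset.sum_congr (s₁ := Finset.univ) rfl fun j _ ↦ h1 j
    rw [← Finset.sum_mul, ← hN, ← Finset.mul_sum, Finset.sum_sub_distrib, ← Finset.mul_sum,
      ← hX, hC'] at h2
    have h3 : ric k l - (sc - r) / ((n : ℝ) - 1) * g k l =
        X k * (r * X l - (sc - r) / ((n : ℝ) - 1) * X l) / N := by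
      rw [← h2]; field_simp
    rw [← sub_eq_iff_eq_add', h3]
    field_simp
    ring
  · intro h0 j k l
    rw [h0 k l, h0 j l]
    ring

end CurvatureAlgebra

section Components

variable {n : ℕ} {M : Type*} [TopologicalSpace M] [ChartedSpace (EuclideanSpace ℝ (Fin n)) M]
  [IsManifold (𝓡 n) ∞ M]

open Filter Topology

set_option synthInstance.maxHeartbeats 400000

lemma eq_of_isLinearMap {F : Type*} [NormedAddCommGroup F] [NormedSpace ℝ F]
    {f h : EuclideanSpace ℝ (Fin n) → F} (hf : IsLinearMap ℝ f) (hh : IsLinearMap ℝ h)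
    (H : ∀ i, f (EuclideanSpace.single i 1) = h (EuclideanSpace.single i 1))
    (u : EuclideanSpace ℝ (Fin n)) : f u = h u := by
  have h1 := linearMap_apply_eq_sum hf.mk' u
  have h2 := linearMap_apply_eq_sum hh.mk' u
  simp only [IsLinearMap.mk'_apply] at h1 h2
  rw [h1, h2]
  exact Finset.sum_congr rfl fun i _ ↦ by rw [H]

lemma eq_of_isLinearMap₂ {F : Type*} [NormedAddCommGroup F] [NormedSpace ℝ F]
    {f h : EuclideanSpace ℝ (Fin n) → EuclideanSpace ℝ (Fin n) → F}
    (f₁ : ∀ v, IsLinearMap ℝ fun u ↦ f u v) (f₂ : ∀ u, IsLinearMap ℝ fun v ↦ f u v)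
    (h₁ : ∀ v, IsLinearMap ℝ fun u ↦ h u v) (h₂ : ∀ u, IsLinearMap ℝ fun v ↦ h u v)
    (H : ∀ i j, f (EuclideanSpace.single i 1) (EuclideanSpace.single j 1) =
      h (EuclideanSpace.single i 1) (EuclideanSpace.single j 1))
    (u v : EuclideanSpace ℝ (Fin n)) : f u v = h u v :=
  eq_of_isLinearMap (f₁ v) (h₁ v) (fun i ↦ eq_of_isLinearMap (f₂ _) (h₂ _) (H i) v) u

lemma eq_of_isLinearMap₃ {F : Type*} [NormedAddCommGroup F] [NormedSpace ℝ F]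
    {f h : EuclideanSpace ℝ (Fin n) → EuclideanSpace ℝ (Fin n) → EuclideanSpace ℝ (Fin n) → F}
    (f₁ : ∀ v w, IsLinearMap ℝ fun u ↦ f u v w) (f₂ : ∀ u w, IsLinearMap ℝ fun v ↦ f u v w)
    (f₃ : ∀ u v, IsLinearMap ℝ fun w ↦ f u v w)
    (h₁ : ∀ v w, IsLinearMap ℝ fun u ↦ h u v w) (h₂ : ∀ u w, IsLinearMap ℝ fun v ↦ h u v w)
    (h₃ : ∀ u v, IsLinearMap ℝ fun w ↦ h u v w)
    (H : ∀ i j k, f (EuclideanSpace.single i 1) (EuclideanSpace.single j 1)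
        (EuclideanSpace.single k 1) =
      h (EuclideanSpace.single i 1) (EuclideanSpace.single j 1) (EuclideanSpace.single k 1))
    (u v w : EuclideanSpace ℝ (Fin n)) : f u v w = h u v w :=
  eq_of_isLinearMap (f₁ v w) (h₁ v w) (fun i ↦
    eq_of_isLinearMap₂ (f₂ _) (f₃ _) (h₂ _) (h₃ _) (H i) v w) u

variable (g : LorentzMetric n M) {e : OpenPartialHomeomorph M (EuclideanSpace ℝ (Fin n))}

lemma christoffel_symm (k i j : Fin n) (x : EuclideanSpace ℝ (Fin n)) :
    christoffel g e k i j x = christoffel g e k j i x := by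
  have : metric g e i j = metric g e j i := funext fun x ↦ metric_symm g e x i j
  simp only [christoffel, this]
  congr 1
  exact Finset.sum_congr rfl fun l _ ↦ by ring

lemma christoffelMap_symm (x u v : EuclideanSpace ℝ (Fin n)) :
    christoffelMap g e x u v = christoffelMap g e x v u := by
  simp only [christoffelMap, bilin_apply]
  rw [Finset.sum_comm]
  refine Finset.sum_congr rfl fun i _ ↦ Finset.sum_congr rfl fun j _ ↦ ?_
  rw [smul_comm]
  congr 3
  ext k
  exact christoffel_symm g k j i x

variable {x : EuclideanSpace ℝ (Fin n)}

lemma contDiffAt_metricForm (he : e ∈ atlas (EuclideanSpace ℝ (Fin n)) M) (hx : x ∈ e.target) :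
    ContDiffAt ℝ ∞ (metricForm g e) x :=
  (contDiffOn_metricForm g he).contDiffAt (e.open_target.mem_nhds hx)

lemma differentiableAt_metricForm (he : e ∈ atlas (EuclideanSpace ℝ (Fin n)) M)
    (hx : x ∈ e.target) : DifferentiableAt ℝ (metricForm g e) x :=
  (contDiffAt_metricForm g he hx).differentiableAt (by simp)

lemma differentiableAt_christoffelMap (he : e ∈ atlas (EuclideanSpace ℝ (Fin n)) M)
    (hx : x ∈ e.target) : DifferentiableAt ℝ (christoffelMap g e) x :=
  ((contDiffOn_christoffelMap g he).contDiffAt (e.open_target.mem_nhds hx)).differentiableAt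
    (by simp)

lemma fderiv_metricForm_single (he : e ∈ atlas (EuclideanSpace ℝ (Fin n)) M) (hx : x ∈ e.target)
    (i j k : Fin n) :
    fderiv ℝ (metricForm g e) x (EuclideanSpace.single i 1) (EuclideanSpace.single j 1)
      (EuclideanSpace.single k 1) = pd i (metric g e j k) x := by
  rw [← fderiv_bilinear_const (differentiableAt_metricForm g he hx), pd]
  simp only [metricForm_single]

lemma fderiv_christoffelMap_single (he : e ∈ atlas (EuclideanSpace ℝ (Fin n)) M)
    (hx : x ∈ e.target) (l i j m : Fin n) :
    fderiv ℝ (christoffelMap g e) x (EuclideanSpace.single l 1) (EuclideanSpace.single i 1)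
      (EuclideanSpace.single j 1) m = pd l (christoffel g e m i j) x := by
  have hd := differentiableAt_christoffelMap g he hx
  rw [← fderiv_bilinear_const hd, pd]
  have h : christoffel g e m i j = fun y ↦ (EuclideanSpace.proj (𝕜 := ℝ) m :
      EuclideanSpace ℝ (Fin n) →L[ℝ] ℝ) (christoffelMap g e y (EuclideanSpace.single i 1)
        (EuclideanSpace.single j 1)) :=
    funext fun y ↦ (christoffelMap_single g e y i j m).symm
  rw [h, fderiv_linear_apply (differentiableAt_const _) (differentiableAt_bilinear_const hd _ _)]
  simp

lemma koszul_single (he : e ∈ atlas (EuclideanSpace ℝ (Fin n)) M) (hx : x ∈ e.target)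
    (i j m : Fin n) :
    2 * metricForm g e x (christoffelMap g e x (EuclideanSpace.single i 1)
      (EuclideanSpace.single j 1)) (EuclideanSpace.single m 1) =
      pd i (metric g e j m) x + pd j (metric g e i m) x - pd m (metric g e i j) x := by
  have h1 : metricForm g e x (christoffelMap g e x (EuclideanSpace.single i 1)
      (EuclideanSpace.single j 1)) (EuclideanSpace.single m 1) =
      ∑ k, christoffel g e k i j x * metric g e k m x := by
    rw [metricForm_symm]
    have := linearMap_apply_eq_sum (metricForm g e x (EuclideanSpace.single m 1)).toLinearMap
      (christoffelMap g e x (EuclideanSpace.single i 1) (EuclideanSpace.single j 1))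
    simp only [ContinuousLinearMap.coe_coe, christoffelMap_single, metricForm_single] at this
    rw [this]
    exact Finset.sum_congr rfl fun k _ ↦ by rw [metric_symm g e x m k]; rfl
  rw [h1]
  simp only [christoffel, Finset.mul_sum, Finset.sum_mul]
  rw [Finset.sum_comm]
  have h2 (l : Fin n) (c : ℝ) : ∑ k, 2 * (1 / 2 * (invMetric g e k l x * c) * metric g e k m x) =
      c * if m = l then 1 else 0 := by
    rw [← sum_metric_mul_invMetric g he hx m l, Finset.mul_sum]
    exact Finset.sum_congr rfl fun k _ ↦ by rw [metric_symm g e x k m]; ring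
  simp only [h2]
  simp

/-- The Koszul formula. -/
lemma koszul (he : e ∈ atlas (EuclideanSpace ℝ (Fin n)) M) (hx : x ∈ e.target)
    (u v w : EuclideanSpace ℝ (Fin n)) :
    2 * metricForm g e x (christoffelMap g e x u v) w =
      fderiv ℝ (metricForm g e) x u v w + fderiv ℝ (metricForm g e) x v u w
        - fderiv ℝ (metricForm g e) x w u v := by
  refine eq_of_isLinearMap₃ (f := fun u v w ↦ 2 * metricForm g e x (christoffelMap g e x u v) w)
    (h := fun u v w ↦ fderiv ℝ (metricForm g e) x u v w + fderiv ℝ (metricForm g e) x v u w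
        - fderiv ℝ (metricForm g e) x w u v) ?_ ?_ ?_ ?_ ?_ ?_ ?_ u v w
  iterate 6
    exact fun a b ↦ ⟨fun c d ↦ by simp only [map_add, add_apply]; ring,
      fun c d ↦ by simp only [map_smul, smul_apply, smul_eq_mul]; ring⟩
  intro i j m
  simp only [fderiv_metricForm_single g he hx, koszul_single g he hx]

lemma fderiv_metricForm_symm (he : e ∈ atlas (EuclideanSpace ℝ (Fin n)) M) (hx : x ∈ e.target)
    (u v w : EuclideanSpace ℝ (Fin n)) :
    fderiv ℝ (metricForm g e) x u v w = fderiv ℝ (metricForm g e) x u w v := by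
  have hd := differentiableAt_metricForm g he hx
  rw [← fderiv_bilinear_const hd, ← fderiv_bilinear_const hd]
  simp only [metricForm_symm g e _ v w]

/-- The Levi-Civita connection is compatible with the metric. -/
lemma metric_compatible (he : e ∈ atlas (EuclideanSpace ℝ (Fin n)) M) (hx : x ∈ e.target)
    (u v w : EuclideanSpace ℝ (Fin n)) :
    fderiv ℝ (metricForm g e) x u v w = metricForm g e x (christoffelMap g e x u v) w +
      metricForm g e x v (christoffelMap g e x u w) := by
  have h1 := koszul g he hx u v w
  have h2 := koszul g he hx u w v
  have h3 := fderiv_metricForm_symm g he hx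
  rw [metricForm_symm g e x v]
  linarith [h3 u w v, h3 v u w, h3 w u v]

lemma curv_single (he : e ∈ atlas (EuclideanSpace ℝ (Fin n)) M) (hx : x ∈ e.target)
    (i j k m : Fin n) :
    curv (christoffelMap g e) x (EuclideanSpace.single i 1) (EuclideanSpace.single j 1)
      (EuclideanSpace.single k 1) m = riemannUp g e i j k m x := by
  have h (a b c : Fin n) : christoffelMap g e x (EuclideanSpace.single a 1)
      (christoffelMap g e x (EuclideanSpace.single b 1) (EuclideanSpace.single c 1)) m =
      ∑ l, christoffel g e m a l x * christoffel g e l b c x := by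
    rw [eq_sum_single (christoffelMap g e x (EuclideanSpace.single b 1)
      (EuclideanSpace.single c 1))]
    simp only [map_sum, map_smul, christoffelMap_single, WithLp.ofLp_sum, Finset.sum_apply,
      PiLp.smul_apply, smul_eq_mul]
    exact Finset.sum_congr rfl fun l _ ↦ mul_comm _ _
  simp only [curv, PiLp.add_apply, PiLp.sub_apply, fderiv_christoffelMap_single g he hx, h,
    riemannUp, Finset.sum_sub_distrib]

lemma riemann_eq (he : e ∈ atlas (EuclideanSpace ℝ (Fin n)) M) (hx : x ∈ e.target)
    (i j k : Fin n) (w : EuclideanSpace ℝ (Fin n)) :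
    ∑ m, riemann g e i j k m x * w m =
    metricForm g e x (curv (christoffelMap g e) x (EuclideanSpace.single i 1)
      (EuclideanSpace.single j 1) (EuclideanSpace.single k 1)) w := by
  rw [metricForm, bilin_apply, Finset.sum_comm]
  refine Finset.sum_congr rfl fun m _ ↦ ?_
  rw [riemann, Finset.sum_mul]
  refine Finset.sum_congr rfl fun l _ ↦ ?_
  rw [curv_single g he hx, smul_eq_mul, smul_eq_mul]
  ring

lemma riemann_eq_single (he : e ∈ atlas (EuclideanSpace ℝ (Fin n)) M) (hx : x ∈ e.target)
    (i j k m : Fin n) :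
    riemann g e i j k m x =
    metricForm g e x (curv (christoffelMap g e) x (EuclideanSpace.single i 1)
      (EuclideanSpace.single j 1) (EuclideanSpace.single k 1)) (EuclideanSpace.single m 1) := by
  rw [← riemann_eq g he hx]
  simp

lemma riemannUp_swap (i j k m : Fin n) (x : EuclideanSpace ℝ (Fin n)) :
    riemannUp g e i j k m x = -riemannUp g e j i k m x := by
  simp only [riemannUp, Finset.sum_sub_distrib]
  ring

lemma riemann_swap (i j k m : Fin n) (x : EuclideanSpace ℝ (Fin n)) :
    riemann g e i j k m x = -riemann g e j i k m x := by
  simp only [riemann, ← Finset.sum_neg_distrib]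
  exact Finset.sum_congr rfl fun l _ ↦ by rw [riemannUp_swap, neg_mul]

lemma riemann_skew (he : e ∈ atlas (EuclideanSpace ℝ (Fin n)) M) (hx : x ∈ e.target)
    (i j k m : Fin n) : riemann g e i j k m x = -riemann g e i j m k x := by
  rw [riemann_eq_single g he hx, riemann_eq_single g he hx, eq_neg_iff_add_eq_zero]
  have := curv_skew ((contDiffAt_metricForm g he hx).of_le (by norm_cast))
    (differentiableAt_christoffelMap g he hx)
    (Filter.eventually_of_mem (e.open_target.mem_nhds hx) fun y hy ↦ metric_compatible g he hy)
    (EuclideanSpace.single i 1) (EuclideanSpace.single j 1) (EuclideanSpace.single k 1)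
    (EuclideanSpace.single m 1)
  rw [← this, metricForm_symm g e x (EuclideanSpace.single k 1)]

lemma christoffel_comm (k i j : Fin n) : christoffel g e k i j = christoffel g e k j i :=
  funext fun x ↦ christoffel_symm g k i j x

/-- The first Bianchi identity. -/
lemma riemann_bianchi (i j k m : Fin n) (x : EuclideanSpace ℝ (Fin n)) :
    riemann g e i j k m x + riemann g e j k i m x + riemann g e k i j m x = 0 := by
  have h (l : Fin n) :
      riemannUp g e i j k l x + riemannUp g e j k i l x + riemannUp g e k i j l x = 0 := by
    simp only [riemannUp, Finset.sum_sub_distrib]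
    rw [christoffel_comm g l k i, christoffel_comm g l j i, christoffel_comm g l k j]
    simp only [christoffel_symm g _ k i, christoffel_symm g _ j i, christoffel_symm g _ k j]
    ring
  simp only [riemann, ← Finset.sum_add_distrib, ← add_mul, h]
  simp

/-- The covector field `g(X, ·)` in the chart `e`. -/
def covector (g : LorentzMetric n M) (X : ∀ p : M, TangentSpace (𝓡 n) p)
    (e : OpenPartialHomeomorph M (EuclideanSpace ℝ (Fin n))) (x : EuclideanSpace ℝ (Fin n)) :
    EuclideanSpace ℝ (Fin n) →L[ℝ] ℝ :=
  metricForm g e x (upperVec e X x)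

lemma covector_single (X : ∀ p : M, TangentSpace (𝓡 n) p) (k : Fin n)
    (x : EuclideanSpace ℝ (Fin n)) :
    covector g X e x (EuclideanSpace.single k 1) = lower g X e k x := by
  rw [covector, metricForm_symm]
  have := linearMap_apply_eq_sum (metricForm g e x (EuclideanSpace.single k 1)).toLinearMap
    (upperVec e X x)
  simp only [ContinuousLinearMap.coe_coe, metricForm_single] at this
  rw [this]
  exact Finset.sum_congr rfl fun l _ ↦ mul_comm _ _

lemma sum_lower_mul_upper (he : e ∈ atlas (EuclideanSpace ℝ (Fin n)) M) (hx : x ∈ e.target)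
    (X : ∀ p : M, TangentSpace (𝓡 n) p) :
    g.val (e.symm x) (X (e.symm x)) (X (e.symm x)) = ∑ k, lower g X e k x * upper X e k x := by
  rw [← metricForm_upperVec g he hx]
  have := linearMap_apply_eq_sum (covector g X e x).toLinearMap (upperVec e X x)
  simp only [ContinuousLinearMap.coe_coe, covector_single] at this
  rw [covector] at this
  rw [this]
  exact Finset.sum_congr rfl fun l _ ↦ mul_comm _ _

variable {g} in
/-- The integrability condition of a concircular vector field. -/
lemma IsChenVector.riemann_contract {X : ∀ p : M, TangentSpace (𝓡 n) p} (hX : IsChenVector g X)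
    (he : e ∈ atlas (EuclideanSpace ℝ (Fin n)) M) (hx : x ∈ e.target) :
    ∃ d : Fin n → ℝ, ∀ i j k, ∑ m, riemann g e i j k m x * upper X e m x =
      d i * metric g e j k x - d j * metric g e i k x := by
  obtain ⟨ρ, hρ, hc⟩ := hX.concircular
  have hω : ContDiffOn ℝ ∞ (covector g X e) e.target :=
    (contDiffOn_metricForm g he).clm_apply (contDiffOn_upperVec he hX.contMDiff)
  have hρ' : ContDiffOn ℝ ∞ (fun y ↦ ρ (e.symm y)) e.target :=
    contMDiffOn_iff_contDiffOn.1 (hρ.comp_contMDiffOn (contMDiffOn_atlas_symm he))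
  have hcc (y) (hy : y ∈ e.target) (u v : EuclideanSpace ℝ (Fin n)) :
      fderiv ℝ (covector g X e) y u v =
        covector g X e y (christoffelMap g e y u v) + ρ (e.symm y) * metricForm g e y u v := by
    refine eq_of_isLinearMap₂ (f := fun u v ↦ fderiv ℝ (covector g X e) y u v)
      (h := fun u v ↦ covector g X e y (christoffelMap g e y u v) +
        ρ (e.symm y) * metricForm g e y u v) ?_ ?_ ?_ ?_ ?_ u v
    iterate 4
      exact fun a ↦ ⟨fun c d ↦ by simp only [map_add, add_apply]; try ring,
        fun c d ↦ by simp only [map_smul, smul_apply, smul_eq_mul]; try ring⟩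
    intro j k
    have hd : DifferentiableAt ℝ (covector g X e) y :=
      (hω.contDiffAt (e.open_target.mem_nhds hy)).differentiableAt (by simp)
    have h1 := hc e he y hy j k
    have h2 : covector g X e y (christoffelMap g e y (EuclideanSpace.single j 1)
        (EuclideanSpace.single k 1)) = ∑ l, christoffel g e l j k y * lower g X e l y := by
      have := linearMap_apply_eq_sum (covector g X e y).toLinearMap
        (christoffelMap g e y (EuclideanSpace.single j 1) (EuclideanSpace.single k 1))
      simp only [ContinuousLinearMap.coe_coe, covector_single, christoffelMap_single] at this
      exact this
    have h3 : pd j (lower g X e k) y = fderiv ℝ (covector g X e) y (EuclideanSpace.single j 1)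
        (EuclideanSpace.single k 1) := by
      rw [← fderiv_linear_const hd, pd]
      simp only [covector_single]
    rw [h2, metricForm_single, ← h1, covDeriv, h3]
    ring
  have hm := e.open_target.mem_nhds hx
  refine ⟨fun i ↦ fderiv ℝ (fun y ↦ ρ (e.symm y)) x (EuclideanSpace.single i 1),
    fun i j k ↦ ?_⟩
  have := curv_concircular (differentiableAt_metricForm g he hx)
    (differentiableAt_christoffelMap g he hx)
    ((hω.contDiffAt hm).of_le (by norm_cast))
    ((hρ'.contDiffAt hm).differentiableAt (by simp)) (christoffelMap_symm g x)
    (metric_compatible g he hx) (Filter.eventually_of_mem hm hcc)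
    (EuclideanSpace.single i 1) (EuclideanSpace.single j 1) (EuclideanSpace.single k 1)
  rw [metricForm_single, metricForm_single] at this
  rw [← this, covector, metricForm_symm, ← riemann_eq g he hx]
  rfl

end Components

section RicciForm

variable {n : ℕ} {M : Type*} [TopologicalSpace M] [ChartedSpace (EuclideanSpace ℝ (Fin n)) M]
  [IsManifold (𝓡 n) ∞ M]

set_option synthInstance.maxHeartbeats 400000
set_option maxHeartbeats 1000000

variable {E : Type*} [NormedAddCommGroup E] [NormedSpace ℝ E]

/-- The endomorphism `v ↦ R(u, v) w`. -/
def curvEnd (Γ : E → E →L[ℝ] E →L[ℝ] E) (x u w : E) : E →ₗ[ℝ] E where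
  toFun v := curv Γ x u v w
  map_add' a b := by simp only [curv, map_add, add_apply]; abel
  map_smul' c a := by
    simp only [curv, map_smul, smul_apply, smul_sub, smul_add, RingHom.id_apply]

/-- The Ricci tensor of the connection with Christoffel map `Γ`. -/
def ricciForm (Γ : E → E →L[ℝ] E →L[ℝ] E) (x u w : E) : ℝ :=
  LinearMap.trace ℝ E (curvEnd Γ x u w)

lemma isLinearMap_ricciForm_left (Γ : E → E →L[ℝ] E →L[ℝ] E) (x w : E) :
    IsLinearMap ℝ fun u ↦ ricciForm Γ x u w where
  map_add a b := by
    rw [ricciForm, ricciForm, ricciForm, ← map_add]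
    congr 1
    ext v
    simp only [curvEnd, curv, LinearMap.coe_mk, AddHom.coe_mk, LinearMap.add_apply, map_add,
      add_apply]
    abel
  map_smul c a := by
    rw [ricciForm, ricciForm, ← map_smul]
    congr 1
    ext v
    simp only [curvEnd, curv, LinearMap.coe_mk, AddHom.coe_mk, LinearMap.smul_apply, map_smul,
      smul_apply, smul_sub, smul_add]

lemma isLinearMap_ricciForm_right (Γ : E → E →L[ℝ] E →L[ℝ] E) (x u : E) :
    IsLinearMap ℝ fun w ↦ ricciForm Γ x u w where
  map_add a b := by
    rw [ricciForm, ricciForm, ricciForm, ← map_add]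
    congr 1
    ext v
    simp only [curvEnd, curv, LinearMap.coe_mk, AddHom.coe_mk, LinearMap.add_apply, map_add]
    abel
  map_smul c a := by
    rw [ricciForm, ricciForm, ← map_smul]
    congr 1
    ext v
    simp only [curvEnd, curv, LinearMap.coe_mk, AddHom.coe_mk, LinearMap.smul_apply, map_smul,
      smul_sub, smul_add]

lemma ricciForm_transform {Γ Γ' : E → E →L[ℝ] E →L[ℝ] E} {x y : E} (A : E ≃ₗ[ℝ] E)
    (h : ∀ u v w, A (curv Γ' x u v w) = curv Γ y (A u) (A v) (A w)) (u w : E) :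
    ricciForm Γ' x u w = ricciForm Γ y (A u) (A w) := by
  rw [ricciForm, ricciForm, ← LinearMap.trace_conj' _ A]
  congr 1
  ext v
  simp only [LinearEquiv.conj_apply, LinearMap.comp_apply, LinearEquiv.coe_coe, curvEnd,
    LinearMap.coe_mk, AddHom.coe_mk, h, LinearEquiv.apply_symm_apply]

variable (g : LorentzMetric n M) {e : OpenPartialHomeomorph M (EuclideanSpace ℝ (Fin n))}
  {x : EuclideanSpace ℝ (Fin n)}

lemma ricci_eq_sum_riemannUp (he : e ∈ atlas (EuclideanSpace ℝ (Fin n)) M) (hx : x ∈ e.target)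
    (j l : Fin n) : ricci g e j l x = ∑ k, riemannUp g e j k l k x := by
  rw [ricci]
  refine Finset.sum_congr rfl fun k _ ↦ ?_
  simp only [riemann, Finset.mul_sum]
  rw [Finset.sum_comm]
  have (p : Fin n) : ∑ m, invMetric g e k m x * (riemannUp g e j k l p x * metric g e p m x) =
      riemannUp g e j k l p x * if k = p then 1 else 0 := by
    rw [← sum_invMetric_mul_metric g he hx k p, Finset.mul_sum]
    exact Finset.sum_congr rfl fun m _ ↦ by rw [metric_symm g e x p m]; ring
  simp only [this]
  simp

lemma ricciForm_single (he : e ∈ atlas (EuclideanSpace ℝ (Fin n)) M) (hx : x ∈ e.target)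
    (j l : Fin n) :
    ricciForm (christoffelMap g e) x (EuclideanSpace.single j 1) (EuclideanSpace.single l 1) =
      ricci g e j l x := by
  rw [ricci_eq_sum_riemannUp g he hx, ricciForm,
    LinearMap.trace_eq_matrix_trace ℝ (EuclideanSpace.basisFun (Fin n) ℝ).toBasis, Matrix.trace]
  refine Finset.sum_congr rfl fun k _ ↦ ?_
  rw [← curv_single g he hx]
  simp [LinearMap.toMatrix_apply, curvEnd]

end RicciForm

section Transition

variable {n : ℕ} {M : Type*} [TopologicalSpace M] [ChartedSpace (EuclideanSpace ℝ (Fin n)) M]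
  [IsManifold (𝓡 n) ∞ M]

set_option synthInstance.maxHeartbeats 400000

open Filter Topology

variable (g : LorentzMetric n M) {e e' : OpenPartialHomeomorph M (EuclideanSpace ℝ (Fin n))}
  {x : EuclideanSpace ℝ (Fin n)}

/-- The coordinate change from the chart `e` to the chart `e'`. -/
def transition (e e' : OpenPartialHomeomorph M (EuclideanSpace ℝ (Fin n)))
    (x : EuclideanSpace ℝ (Fin n)) : EuclideanSpace ℝ (Fin n) := e' (e.symm x)

omit [ChartedSpace (EuclideanSpace ℝ (Fin n)) M] [IsManifold (𝓡 n) ∞ M] in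
lemma mem_of_mem_transition (hx : x ∈ (e.symm.trans e').source) :
    x ∈ e.target ∧ e.symm x ∈ e'.source := by simpa using hx

lemma contDiffOn_transition (he : e ∈ atlas (EuclideanSpace ℝ (Fin n)) M)
    (he' : e' ∈ atlas (EuclideanSpace ℝ (Fin n)) M) :
    ContDiffOn ℝ ∞ (transition e e') (e.symm.trans e').source := by
  rw [← contMDiffOn_iff_contDiffOn]
  exact (contMDiffOn_atlas he').comp' (contMDiffOn_atlas_symm he)

lemma dsymm_transition (he : e ∈ atlas (EuclideanSpace ℝ (Fin n)) M)
    (he' : e' ∈ atlas (EuclideanSpace ℝ (Fin n)) M) (hx : x ∈ (e.symm.trans e').source)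
    (u : EuclideanSpace ℝ (Fin n)) :
    (dsymm e' (transition e e' x) (fderiv ℝ (transition e e') x u) : EuclideanSpace ℝ (Fin n)) =
      dsymm e x u := by
  have hx' := mem_of_mem_transition hx
  have hd' : e'.MDifferentiable (𝓡 n) (𝓡 n) := mdifferentiable_of_mem_atlas he'
  have hd : e.MDifferentiable (𝓡 n) (𝓡 n) := mdifferentiable_of_mem_atlas he
  have h1 := (hd'.mdifferentiableAt_symm (e'.map_source hx'.2)).hasMFDerivAt
  have h2 : HasMFDerivAt (𝓡 n) (𝓡 n) (transition e e') x (fderiv ℝ (transition e e') x) :=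
    (((contDiffOn_transition he he').contDiffAt
      ((e.symm.trans e').open_source.mem_nhds hx)).differentiableAt
        (by simp)).hasFDerivAt.hasMFDerivAt
  have h3 := HasMFDerivAt.comp x h1 h2
  have h4 : HasMFDerivAt (𝓡 n) (𝓡 n) e.symm x _ := h3.congr_of_eventuallyEq
    (Filter.eventually_of_mem ((e.symm.trans e').open_source.mem_nhds hx) fun y hy ↦ by
      exact (e'.left_inv (mem_of_mem_transition hy).2).symm)
  have h5 := hasMFDerivAt_unique h4 (hd.mdifferentiableAt_symm hx'.1).hasMFDerivAt
  exact DFunLike.congr_fun h5 u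

lemma metricForm_apply_of_eq {p : M} (hp : e.symm x = p) (u v : EuclideanSpace ℝ (Fin n)) :
    metricForm g e x u v = g.val p (dsymm e x u : EuclideanSpace ℝ (Fin n))
      (dsymm e x v : EuclideanSpace ℝ (Fin n)) := by
  subst hp
  exact metricForm_apply g e x u v

lemma covector_apply_of_eq (he : e ∈ atlas (EuclideanSpace ℝ (Fin n)) M) (hx : x ∈ e.target)
    (X : ∀ p : M, TangentSpace (𝓡 n) p) {p : M} (hp : e.symm x = p)
    (u : EuclideanSpace ℝ (Fin n)) :
    covector g X e x u = g.val p (X p) (dsymm e x u : EuclideanSpace ℝ (Fin n)) := by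
  subst hp
  rw [covector, metricForm_apply, dsymm_upperVec he hx]

omit [ChartedSpace (EuclideanSpace ℝ (Fin n)) M] [IsManifold (𝓡 n) ∞ M] in
lemma transition_mem_target (hx : x ∈ (e.symm.trans e').source) :
    transition e e' x ∈ e'.target := e'.map_source (mem_of_mem_transition hx).2

omit [ChartedSpace (EuclideanSpace ℝ (Fin n)) M] [IsManifold (𝓡 n) ∞ M] in
lemma symm_transition (hx : x ∈ (e.symm.trans e').source) :
    e'.symm (transition e e' x) = e.symm x := e'.left_inv (mem_of_mem_transition hx).2

variable (he : e ∈ atlas (EuclideanSpace ℝ (Fin n)) M)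
  (he' : e' ∈ atlas (EuclideanSpace ℝ (Fin n)) M) (hx : x ∈ (e.symm.trans e').source)

include he he' hx

lemma metricForm_transition (u v : EuclideanSpace ℝ (Fin n)) :
    metricForm g e x u v = metricForm g e' (transition e e' x)
      (fderiv ℝ (transition e e') x u) (fderiv ℝ (transition e e') x v) := by
  rw [metricForm_apply_of_eq g (symm_transition hx), dsymm_transition he he' hx,
    dsymm_transition he he' hx, metricForm_apply_of_eq g rfl]

lemma covector_transition (X : ∀ p : M, TangentSpace (𝓡 n) p) (u : EuclideanSpace ℝ (Fin n)) :
    covector g X e x u =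
      covector g X e' (transition e e' x) (fderiv ℝ (transition e e') x u) := by
  rw [covector_apply_of_eq g he' (transition_mem_target hx) X (symm_transition hx),
    dsymm_transition he he' hx, covector_apply_of_eq g he (mem_of_mem_transition hx).1 X rfl]

lemma fderiv_transition_injective : Function.Injective (fderiv ℝ (transition e e') x) := by
  intro u v huv
  apply dsymm_injective he (mem_of_mem_transition hx).1
  have h1 := dsymm_transition he he' hx u
  rw [huv] at h1
  exact h1.symm.trans (dsymm_transition he he' hx v)

lemma fderiv_transition_surjective : Function.Surjective (fderiv ℝ (transition e e') x) :=
  LinearMap.surjective_of_injective (f := (fderiv ℝ (transition e e') x).toLinearMap)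
    (fderiv_transition_injective he he' hx)

lemma contDiffAt_transition : ContDiffAt ℝ ∞ (transition e e') x :=
  (contDiffOn_transition he he').contDiffAt ((e.symm.trans e').open_source.mem_nhds hx)

lemma christoffelMap_transition (u v : EuclideanSpace ℝ (Fin n)) :
    fderiv ℝ (transition e e') x (christoffelMap g e x u v) =
      secondDeriv (transition e e') x u v + christoffelMap g e' (transition e e' x)
        (fderiv ℝ (transition e e') x u) (fderiv ℝ (transition e e') x v) :=
  christoffel_transform ((contDiffAt_transition he he' hx).of_le (by norm_cast))
    (differentiableAt_metricForm g he' (transition_mem_target hx))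
    (differentiableAt_metricForm g he (mem_of_mem_transition hx).1)
    (metricForm_symm g e' _)
    (fun _ h ↦ metricForm_nondegenerate g he' (transition_mem_target hx) h)
    (fderiv_transition_surjective he he' hx)
    (Filter.eventually_of_mem ((e.symm.trans e').open_source.mem_nhds hx) fun y hy ↦
      metricForm_transition g he he' hy)
    (koszul g he' (transition_mem_target hx)) (koszul g he (mem_of_mem_transition hx).1) u v

lemma curv_transition (u v w : EuclideanSpace ℝ (Fin n)) :
    fderiv ℝ (transition e e') x (curv (christoffelMap g e) x u v w) =
      curv (christoffelMap g e') (transition e e' x) (fderiv ℝ (transition e e') x u)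
        (fderiv ℝ (transition e e') x v) (fderiv ℝ (transition e e') x w) :=
  curv_transform ((contDiffAt_transition he he' hx).of_le (by norm_cast))
    (differentiableAt_christoffelMap g he' (transition_mem_target hx))
    (differentiableAt_christoffelMap g he (mem_of_mem_transition hx).1)
    (Filter.eventually_of_mem ((e.symm.trans e').open_source.mem_nhds hx) fun y hy ↦
      christoffelMap_transition g he he' hy) u v w

/-- The Ricci tensor is a tensor. -/
lemma ricciForm_transition (u w : EuclideanSpace ℝ (Fin n)) :
    ricciForm (christoffelMap g e) x u w = ricciForm (christoffelMap g e') (transition e e' x)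
      (fderiv ℝ (transition e e') x u) (fderiv ℝ (transition e e') x w) :=
  ricciForm_transform (LinearEquiv.ofBijective (fderiv ℝ (transition e e') x).toLinearMap
    ⟨fderiv_transition_injective he he' hx, fderiv_transition_surjective he he' hx⟩)
    (curv_transition g he he' hx) u w

/-- The perfect-fluid form of the Ricci tensor is independent of the chart. -/
lemma perfectFluid_transition (X : ∀ p : M, TangentSpace (𝓡 n) p) {α β : ℝ}
    (h : ∀ j k, ricci g e' j k (transition e e' x) = α * metric g e' j k (transition e e' x) +
      β * (lower g X e' j (transition e e' x) * lower g X e' k (transition e e' x)))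
    (j k : Fin n) :
    ricci g e j k x = α * metric g e j k x + β * (lower g X e j x * lower g X e k x) := by
  have hy := transition_mem_target hx
  have key (u w : EuclideanSpace ℝ (Fin n)) :
      ricciForm (christoffelMap g e') (transition e e' x) u w =
        α * metricForm g e' (transition e e' x) u w + β * (covector g X e' (transition e e' x) u *
          covector g X e' (transition e e' x) w) := by
    refine eq_of_isLinearMap₂
      (f := fun u w ↦ ricciForm (christoffelMap g e') (transition e e' x) u w)
      (h := fun u w ↦ α * metricForm g e' (transition e e' x) u w +
        β * (covector g X e' (transition e e' x) u * covector g X e' (transition e e' x) w))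
      (isLinearMap_ricciForm_left _ _) (isLinearMap_ricciForm_right _ _) ?_ ?_ ?_ u w
    iterate 2
      exact fun a ↦ ⟨fun c d ↦ by simp only [map_add, add_apply]; ring,
        fun c d ↦ by simp only [map_smul, smul_apply, smul_eq_mul]; ring⟩
    intro i l
    rw [ricciForm_single g he' hy, metricForm_single, covector_single, covector_single, h]
  rw [← ricciForm_single g he (mem_of_mem_transition hx).1, ricciForm_transition g he he' hx, key,
    ← metricForm_transition g he he' hx, ← covector_transition g he he' hx,
    ← covector_transition g he he' hx, metricForm_single, covector_single, covector_single]

end Transition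

section PerfectFluid

variable {n : ℕ} {M : Type*} [TopologicalSpace M] [ChartedSpace (EuclideanSpace ℝ (Fin n)) M]
  [IsManifold (𝓡 n) ∞ M]

variable (g : LorentzMetric n M) (X : ∀ p : M, TangentSpace (𝓡 n) p)

/-- The quotient `R_jk X^j X^k / X²` in the chart `e`. -/
def ricciQuotient (e : OpenPartialHomeomorph M (EuclideanSpace ℝ (Fin n)))
    (x : EuclideanSpace ℝ (Fin n)) : ℝ :=
  (∑ j, ∑ k, ricci g e j k x * upper X e j x * upper X e k x) /
    g.val (e.symm x) (X (e.symm x)) (X (e.symm x))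

/-- The coefficient of `g_jk` in a perfect-fluid Ricci tensor. -/
def metricCoeff (e : OpenPartialHomeomorph M (EuclideanSpace ℝ (Fin n)))
    (x : EuclideanSpace ℝ (Fin n)) : ℝ :=
  (scalarCurv g e x - ricciQuotient g X e x) / ((n : ℝ) - 1)

/-- The coefficient of `X_j X_k / X²` in a perfect-fluid Ricci tensor. -/
def vectorCoeff (e : OpenPartialHomeomorph M (EuclideanSpace ℝ (Fin n)))
    (x : EuclideanSpace ℝ (Fin n)) : ℝ :=
  (n * ricciQuotient g X e x - scalarCurv g e x) / ((n : ℝ) - 1)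

variable {g X} {e e' : OpenPartialHomeomorph M (EuclideanSpace ℝ (Fin n))}
  {x : EuclideanSpace ℝ (Fin n)}

lemma IsChenVector.contDiffOn_ricciQuotient (hX : IsChenVector g X)
    (he : e ∈ atlas (EuclideanSpace ℝ (Fin n)) M) :
    ContDiffOn ℝ ∞ (ricciQuotient g X e) e.target := by
  have hu := contDiffOn_upper hX.contMDiff he
  refine ContDiffOn.div (ContDiffOn.sum fun j _ ↦ ContDiffOn.sum fun k _ ↦
    ((contDiffOn_ricci g he j k).mul (hu j)).mul (hu k)) ?_ fun x _ ↦ (hX.timelike _).ne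
  have hU := contDiffOn_upperVec he hX.contMDiff
  exact (((contDiffOn_metricForm g he).clm_apply hU).clm_apply hU).congr fun x hx ↦
    (metricForm_upperVec g he hx X).symm

lemma IsChenVector.contDiffOn_metricCoeff (hX : IsChenVector g X)
    (he : e ∈ atlas (EuclideanSpace ℝ (Fin n)) M) :
    ContDiffOn ℝ ∞ (metricCoeff g X e) e.target :=
  ((contDiffOn_scalarCurv g he).sub (hX.contDiffOn_ricciQuotient he)).div_const _

lemma IsChenVector.contDiffOn_vectorCoeff (hX : IsChenVector g X)
    (he : e ∈ atlas (EuclideanSpace ℝ (Fin n)) M) :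
    ContDiffOn ℝ ∞ (vectorCoeff g X e) e.target :=
  ((contDiffOn_const.mul (hX.contDiffOn_ricciQuotient he)).sub
    (contDiffOn_scalarCurv g he)).div_const _

/-- The Ricci tensor has the perfect-fluid form in the chart `e` at `x`, with scalars `α`, `β`. -/
def IsPerfectFluidAt (g : LorentzMetric n M) (X : ∀ p : M, TangentSpace (𝓡 n) p)
    (e : OpenPartialHomeomorph M (EuclideanSpace ℝ (Fin n))) (x : EuclideanSpace ℝ (Fin n))
    (α β : ℝ) : Prop :=
  ∀ j k, ricci g e j k x = α * metric g e j k x + β * (lower g X e j x * lower g X e k x /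
    g.val (e.symm x) (X (e.symm x)) (X (e.symm x)))

lemma IsChenVector.coeff_eq (hX : IsChenVector g X) (hn : 3 ≤ n)
    (he : e ∈ atlas (EuclideanSpace ℝ (Fin n)) M) (hx : x ∈ e.target) {α β : ℝ}
    (h : IsPerfectFluidAt g X e x α β) :
    α = metricCoeff g X e x ∧ β = vectorCoeff g X e x :=
  perfectFluid_coefficients hn (metric_symm g e x) (sum_invMetric_mul_metric g he hx) rfl
    (fun _ ↦ rfl) (sum_lower_mul_upper g he hx X) (hX.timelike _).ne h

lemma IsChenVector.weyl_contract_iff (hX : IsChenVector g X) (hn : 3 ≤ n)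
    (he : e ∈ atlas (EuclideanSpace ℝ (Fin n)) M) (hx : x ∈ e.target) :
    (∀ j k l, ∑ m, weyl g e j k l m x * upper X e m x = 0) ↔
      IsPerfectFluidAt g X e x (metricCoeff g X e x) (vectorCoeff g X e x) := by
  obtain ⟨d, hd⟩ := hX.riemann_contract he hx
  exact weyl_contract_eq_zero_iff hn (metric_symm g e x) (fun i j ↦ invMetric_symm g i j x)
    (sum_invMetric_mul_metric g he hx) (fun i j k m ↦ riemann_swap g i j k m x)
    (riemann_skew g he hx) (fun i j k m ↦ riemann_bianchi g i j k m x) (fun _ _ ↦ rfl) hd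
    (fun _ ↦ rfl) (sum_lower_mul_upper g he hx X) (hX.timelike _).ne

lemma IsPerfectFluidAt.transition (he : e ∈ atlas (EuclideanSpace ℝ (Fin n)) M)
    (he' : e' ∈ atlas (EuclideanSpace ℝ (Fin n)) M) (hx : x ∈ (e.symm.trans e').source) {α β : ℝ}
    (h : IsPerfectFluidAt g X e' (transition e e' x) α β) : IsPerfectFluidAt g X e x α β := by
  intro j k
  have h1 := perfectFluid_transition g he he' hx X (α := α)
    (β := β / g.val (e.symm x) (X (e.symm x)) (X (e.symm x))) (fun j k ↦ by
      rw [h j k, symm_transition hx]; ring) j k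
  rw [h1]
  ring

end PerfectFluid

end
end GRW

theorem mainTheorem3 {n : ℕ} (hn : 3 ≤ n) {M : Type*} [TopologicalSpace M]
    [ChartedSpace (EuclideanSpace ℝ (Fin n)) M] [IsManifold (𝓡 n) ∞ M]
    (g : GRW.LorentzMetric n M) (X : ∀ p : M, TangentSpace (𝓡 n) p)
    (hX : GRW.IsChenVector g X) :
    (∀ e ∈ atlas (EuclideanSpace ℝ (Fin n)) M, ∀ x ∈ e.target, ∀ j k l : Fin n,
        ∑ m, GRW.weyl g e j k l m x * GRW.upper X e m x = 0) ↔
      ∃ α β : M → ℝ, ContMDiff (𝓡 n) 𝓘(ℝ, ℝ) ∞ α ∧ ContMDiff (𝓡 n) 𝓘(ℝ, ℝ) ∞ β ∧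
        ∀ e ∈ atlas (EuclideanSpace ℝ (Fin n)) M, ∀ x ∈ e.target, ∀ j k : Fin n,
          GRW.ricci g e j k x =
            α (e.symm x) * GRW.metric g e j k x +
              β (e.symm x) * (GRW.lower g X e j x * GRW.lower g X e k x /
                g.val (e.symm x) (X (e.symm x)) (X (e.symm x))) := by
  constructor
  · intro h
    have hpf (e) (he : e ∈ atlas (EuclideanSpace ℝ (Fin n)) M) (x) (hx : x ∈ e.target) :=
      (hX.weyl_contract_iff hn he hx).1 (h e he x hx)
    have hc (e) (he : e ∈ atlas (EuclideanSpace ℝ (Fin n)) M) (p : M) (hp : p ∈ e.source) :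
        GRW.metricCoeff g X (chartAt (EuclideanSpace ℝ (Fin n)) p)
            (chartAt (EuclideanSpace ℝ (Fin n)) p p) = GRW.metricCoeff g X e (e p) ∧
          GRW.vectorCoeff g X (chartAt (EuclideanSpace ℝ (Fin n)) p)
            (chartAt (EuclideanSpace ℝ (Fin n)) p p) = GRW.vectorCoeff g X e (e p) := by
      have hx := e.map_source hp
      have hc := chart_mem_atlas (EuclideanSpace ℝ (Fin n)) p
      have ht : GRW.transition e (chartAt (EuclideanSpace ℝ (Fin n)) p) (e p) =
          chartAt (EuclideanSpace ℝ (Fin n)) p p := by rw [GRW.transition, e.left_inv hp]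
      have h1 := hpf _ hc _ (OpenPartialHomeomorph.map_source _ (mem_chart_source _ p))
      rw [← ht] at h1 ⊢
      refine hX.coeff_eq hn he hx (h1.transition he hc ?_)
      simp [hx, e.left_inv hp]
    have hsmooth {f : M → ℝ} {F : OpenPartialHomeomorph M (EuclideanSpace ℝ (Fin n)) →
        EuclideanSpace ℝ (Fin n) → ℝ} (hF : ∀ e ∈ atlas (EuclideanSpace ℝ (Fin n)) M,
          ContDiffOn ℝ ∞ (F e) e.target ∧ ∀ p ∈ e.source, f p = F e (e p)) :
        ContMDiff (𝓡 n) 𝓘(ℝ, ℝ) ∞ f := by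
      intro p
      have hc := chart_mem_atlas (EuclideanSpace ℝ (Fin n)) p
      have h1 := (contMDiffOn_iff_contDiffOn.2 (hF _ hc).1).comp (GRW.contMDiffOn_atlas hc)
        fun q hq ↦ OpenPartialHomeomorph.map_source _ hq
      exact (h1.congr (hF _ hc).2).contMDiffAt ((OpenPartialHomeomorph.open_source _).mem_nhds
        (mem_chart_source _ p))
    refine ⟨fun p ↦ GRW.metricCoeff g X (chartAt _ p) (chartAt _ p p),
      fun p ↦ GRW.vectorCoeff g X (chartAt _ p) (chartAt _ p p),
      hsmooth (F := GRW.metricCoeff g X) fun e he ↦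
        ⟨hX.contDiffOn_metricCoeff he, fun p hp ↦ (hc e he p hp).1⟩,
      hsmooth (F := GRW.vectorCoeff g X) fun e he ↦
        ⟨hX.contDiffOn_vectorCoeff he, fun p hp ↦ (hc e he p hp).2⟩, fun e he x hx j k ↦ ?_⟩
    have h1 := hc e he (e.symm x) (e.map_target hx)
    rw [e.right_inv hx] at h1
    simp only [h1.1, h1.2]
    exact hpf e he x hx j k
  · rintro ⟨α, β, -, -, h⟩ e he x hx
    have h1 : GRW.IsPerfectFluidAt g X e x (α (e.symm x)) (β (e.symm x)) := h e he x hx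
    obtain ⟨h2, h3⟩ := hX.coeff_eq hn he hx h1
    rw [h2, h3] at h1
    exact (hX.weyl_contract_iff hn he hx).2 h1
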